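/- Model. A sequential random circuit with $t$ gates on $n$ qubits is a sequence of $t$ independent random gates; each gate acts on a uniformly random pair of distinct qubits by a random two-qubit unitary, which is either (for all gates) Haar distributed on $U(4)$ or (for all gates) a uniformly random two-qubit Clifford unitary. The parallelized random circuit is obtained from it by adding the gates one by one, in order, to a layered circuit: a gate is put into the earliest layer such that it shares no qubit with a gate of that or of a later layer, and a new layer is created at the end if there is none. So no two gates of a layer share a qubit, and the number of layers, called the depth, is the least number of layers into which the sequence can be decomposed. For a density operator $\rho$ on $n$ qubits let $\rho(t)$ be the (random) state obtained by applying the parallelized circuit of $t$ gates to $\rho$, and for a set $S$ of qubits let $\rho_S(t)$ be the partial trace of $\rho(t)$ over the qubits outside $S$. All logarithms are to base 2, $h(x)=-x\log x-(1-x)\log(1-x)$ is the binary entropy and $\|\cdot\|_1$ is the trace norm. Corollary (strong scrambling in depth $O(\log^3 n)$). For either choice of the random two-qubit gates and for every $a\in\mathbb N$ there is a constant $c>0$ such that for every $c'\ge c$ there is a constant $C>0$ with the following property. For every $f\in[0,1]$ with $f\log 3+h(f)-\frac{\log 3}{2}<0$ there is $n_0$ such that for all $n\ge n_0$ and all integers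 $t$ with $c\,n\log^2 n\le t\le c'\,n\log^2 n$: 1. the parallelized random circuit of $t$ gates has depth at most $C\log^3 n$, except with probability at most $n^{-a}$; 2. for every density operator $\rho$ on $n$ qubits and every set $S$ of at most $fn$ qubits, $$\mathbb E\left\|\rho_S(t)-\frac{\mathbb 1}{2^{|S|}}\right\|_1^2\le\frac1{n^{a}},$$ both when the expectation is taken over the parallelized random circuit of $t$ gates, and when it is taken over this circuit conditioned on having depth at most $C\log^3 n$. -/

import Mathlib

open MeasureTheory ProbabilityTheory
open scoped Kronecker ENNReal ComplexOrder

namespace RQC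

noncomputable section

/-! ### Pauli matrices and two-qubit gates -/

/-- The four Pauli matrices `σ₀ = 𝟙, σ₁, σ₂, σ₃`. -/
def pauli : Fin 4 → Matrix (Fin 2) (Fin 2) ℂ :=
  ![!![1, 0; 0, 1], !![0, 1; 1, 0], !![0, -Complex.I; Complex.I, 0], !![1, 0; 0, -1]]

/-- The group `U(4)` of two-qubit unitary matrices. -/
abbrev U4 : Type := Matrix.unitaryGroup (Fin 2 × Fin 2) ℂ

/-- Conjugation by `U` maps every two-qubit Pauli string to a Pauli string, up to sign. -/
def MapsPaulis (U : U4) : Prop :=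
  ∀ a b : Fin 4, ∃ c d : Fin 4,
    (U : Matrix (Fin 2 × Fin 2) (Fin 2 × Fin 2) ℂ) * (pauli a ⊗ₖ pauli b) *
        star (U : Matrix (Fin 2 × Fin 2) (Fin 2 × Fin 2) ℂ) = pauli c ⊗ₖ pauli d ∨
    (U : Matrix (Fin 2 × Fin 2) (Fin 2 × Fin 2) ℂ) * (pauli a ⊗ₖ pauli b) *
        star (U : Matrix (Fin 2 × Fin 2) (Fin 2 × Fin 2) ℂ) = -(pauli c ⊗ₖ pauli d)

theorem mapsPaulis_one : MapsPaulis 1 := fun a b => ⟨a, b, Or.inl (by simp)⟩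

theorem MapsPaulis.mul {U V : U4} (hU : MapsPaulis U) (hV : MapsPaulis V) :
    MapsPaulis (U * V) := by
  intro a b
  obtain ⟨c, d, h⟩ := hV a b
  obtain ⟨c', d', h'⟩ := hU c d
  refine ⟨c', d', ?_⟩
  have key : ∀ X : Matrix (Fin 2 × Fin 2) (Fin 2 × Fin 2) ℂ,
      ((U * V : U4) : Matrix (Fin 2 × Fin 2) (Fin 2 × Fin 2) ℂ) * X *
        star ((U * V : U4) : Matrix (Fin 2 × Fin 2) (Fin 2 × Fin 2) ℂ) =
      (U : Matrix (Fin 2 × Fin 2) (Fin 2 × Fin 2) ℂ) *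
        ((V : Matrix (Fin 2 × Fin 2) (Fin 2 × Fin 2) ℂ) * X *
          star (V : Matrix (Fin 2 × Fin 2) (Fin 2 × Fin 2) ℂ)) *
        star (U : Matrix (Fin 2 × Fin 2) (Fin 2 × Fin 2) ℂ) := by
    intro X
    simp [Matrix.mul_assoc]
  rw [key]
  rcases h with h | h <;> rcases h' with h' | h' <;> rw [h] <;> simp [h']

/-- The two-qubit Clifford group: the unitaries that normalize the Pauli group (global phases
included; they act trivially on states). -/
def cliffordGroup : Subgroup U4 where
  carrier := {U | MapsPaulis U ∧ MapsPaulis U⁻¹}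
  one_mem' := ⟨mapsPaulis_one, by simpa using mapsPaulis_one⟩
  mul_mem' := fun {a b} ha hb => ⟨ha.1.mul hb.1, by
    rw [mul_inv_rev]; exact hb.2.mul ha.2⟩
  inv_mem' := fun {a} ha => ⟨ha.2, by simpa using ha.1⟩

instance compactSpace_U4 : CompactSpace U4 := by
  let _ : NormedAddCommGroup (Matrix (Fin 2 × Fin 2) (Fin 2 × Fin 2) ℂ) :=
    Matrix.normedAddCommGroup
  let _ : NormedSpace ℂ (Matrix (Fin 2 × Fin 2) (Fin 2 × Fin 2) ℂ) := Matrix.normedSpace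
  have hcl : IsClosed (Matrix.unitaryGroup (Fin 2 × Fin 2) ℂ :
      Set (Matrix (Fin 2 × Fin 2) (Fin 2 × Fin 2) ℂ)) := isClosed_unitary
  have hK : IsCompact (Set.pi Set.univ fun _ : Fin 2 × Fin 2 =>
      Set.pi Set.univ fun _ : Fin 2 × Fin 2 => Metric.closedBall (0 : ℂ) 1) :=
    isCompact_univ_pi fun _ => isCompact_univ_pi fun _ => isCompact_closedBall 0 1
  refine isCompact_iff_compactSpace.mp (hK.of_isClosed_subset hcl ?_)
  intro U hU i _ j _
  simpa using entry_norm_bound_of_unitary hU i j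

theorem isClosed_mapsPaulis : IsClosed {U : U4 | MapsPaulis U} := by
  have h : {U : U4 | MapsPaulis U} = ⋂ a : Fin 4, ⋂ b : Fin 4, ⋃ c : Fin 4, ⋃ d : Fin 4,
      ({U : U4 | (U : Matrix (Fin 2 × Fin 2) (Fin 2 × Fin 2) ℂ) * (pauli a ⊗ₖ pauli b) *
        star (U : Matrix (Fin 2 × Fin 2) (Fin 2 × Fin 2) ℂ) = pauli c ⊗ₖ pauli d} ∪
      {U : U4 | (U : Matrix (Fin 2 × Fin 2) (Fin 2 × Fin 2) ℂ) * (pauli a ⊗ₖ pauli b) *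
        star (U : Matrix (Fin 2 × Fin 2) (Fin 2 × Fin 2) ℂ) = -(pauli c ⊗ₖ pauli d)}) := by
    ext U
    simp [MapsPaulis]
  have hc : ∀ a b : Fin 4, Continuous fun U : U4 =>
      (U : Matrix (Fin 2 × Fin 2) (Fin 2 × Fin 2) ℂ) * (pauli a ⊗ₖ pauli b) *
        star (U : Matrix (Fin 2 × Fin 2) (Fin 2 × Fin 2) ℂ) := fun a b =>
    (continuous_subtype_val.mul continuous_const).mul continuous_subtype_val.star
  rw [h]
  refine isClosed_iInter fun a => isClosed_iInter fun b => isClosed_iUnion_of_finite fun c =>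
    isClosed_iUnion_of_finite fun d => IsClosed.union ?_ ?_
  · exact isClosed_eq (hc a b) continuous_const
  · exact isClosed_eq (hc a b) continuous_const

theorem isClosed_cliffordGroup : IsClosed (cliffordGroup : Set U4) :=
  isClosed_mapsPaulis.inter (isClosed_mapsPaulis.preimage continuous_inv)

/-- The two kinds of random two-qubit gates: Haar random on `U(4)`, or a random Clifford gate. -/
inductive GateSet
  | haar
  | clifford

/-- The compact group from which the two-qubit gates are drawn. -/
def gateGroup : GateSet → Subgroup U4
  | .haar => ⊤
  | .clifford => cliffordGroup

instance compactSpace_gateGroup (G : GateSet) : CompactSpace (gateGroup G) := by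
  apply isCompact_iff_compactSpace.mp
  cases G
  · exact isClosed_univ.isCompact
  · exact isClosed_cliffordGroup.isCompact

instance measurableSpace_gateGroup (G : GateSet) : MeasurableSpace (gateGroup G) := borel _

instance borelSpace_gateGroup (G : GateSet) : BorelSpace (gateGroup G) := ⟨rfl⟩

/-- The law of a random two-qubit gate: the Haar probability measure of the gate group. -/
def gateMeasure (G : GateSet) : Measure (gateGroup G) := Measure.haarMeasure ⊤

instance isProbabilityMeasure_gateMeasure (G : GateSet) :
    IsProbabilityMeasure (gateMeasure G) :=
  ⟨by simpa [gateMeasure] using Measure.haarMeasure_self (G := gateGroup G) (K₀ := ⊤)⟩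

/-! ### Qubits, states and circuits -/

/-- Square matrices acting on qubits labelled by `ι`, in the computational basis `ι → {0, 1}`. -/
abbrev Op (ι : Type) : Type := Matrix (ι → Fin 2) (ι → Fin 2) ℂ

/-- The (unordered) pairs of distinct qubits. -/
abbrev Pair (n : ℕ) : Type := {p : Fin n × Fin n // p.1 < p.2}

/-- A gate of the circuit: a pair of qubits together with a two-qubit unitary. -/
abbrev Gate (G : GateSet) (n : ℕ) : Type := Pair n × gateGroup G

/-- The two qubits on which a gate acts. -/
def Gate.qubits {G : GateSet} {n : ℕ} (g : Gate G n) : Finset (Fin n) :=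
  {g.1.1.1, g.1.1.2}

/-- The unitary on `n` qubits of a gate: its two-qubit unitary on its two qubits, tensored with
the identity on all the other qubits. -/
def Gate.mat {G : GateSet} {n : ℕ} (g : Gate G n) : Op (Fin n) :=
  fun x y =>
    if ∀ k, k ∉ Gate.qubits g → x k = y k then
      ((g.2 : U4) : Matrix (Fin 2 × Fin 2) (Fin 2 × Fin 2) ℂ)
        (x g.1.1.1, x g.1.1.2) (y g.1.1.1, y g.1.1.2)
    else 0

/-- The state obtained from `ρ` by applying the gates of a list, the head of the list first. -/
def applyGates {G : GateSet} {n : ℕ} (gs : List (Gate G n)) (ρ : Op (Fin n)) : Op (Fin n) :=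
  gs.foldl (fun ρ g => Gate.mat g * ρ * (Gate.mat g).conjTranspose) ρ

/-- Add a gate to a layered circuit (layers listed in order of execution): it is put into the
earliest layer such that it shares no qubit with any gate of this or of a later layer; if there is
none, a new layer is created at the end. -/
def addGate {G : GateSet} {n : ℕ} (g : Gate G n) :
    List (List (Gate G n)) → List (List (Gate G n))
  | [] => [[g]]
  | L :: Ls =>
    if ∀ h ∈ (L :: Ls).flatten, Disjoint (Gate.qubits g) (Gate.qubits h) then (L ++ [g]) :: Ls
    else L :: addGate g Ls

/-- The parallelized circuit of a sequence of gates: the gates are added one by one, in the order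
of the sequence. No two gates of a layer share a qubit. -/
def parallelize {G : GateSet} {n : ℕ} (gs : List (Gate G n)) : List (List (Gate G n)) :=
  gs.foldl (fun Ls g => addGate g Ls) []

/-- The depth of the parallelized circuit of `t` gates: its number of layers. -/
def depth {G : GateSet} {n t : ℕ} (ω : Fin t → Gate G n) : ℕ :=
  (parallelize (List.ofFn ω)).length

/-- The output state of the parallelized circuit: its layers are applied one after the other. -/
def output {G : GateSet} {n t : ℕ} (ω : Fin t → Gate G n) (ρ : Op (Fin n)) : Op (Fin n) :=
  (parallelize (List.ofFn ω)).foldl (fun ρ L => applyGates L ρ) ρ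

/-- The law of `t` independent random gates, each one acting on a uniformly random pair of
qubits. -/
def circuitMeasure (G : GateSet) (n t : ℕ) : Measure (Fin t → Gate G n) :=
  Measure.pi fun _ => (uniformOn (Set.univ : Set (Pair n))).prod (gateMeasure G)

/-! ### Reduced states, trace norm, entropy -/

/-- The basis string that is `x` on `S` and `z` on the complement of `S`. -/
def glue {n : ℕ} (S : Finset (Fin n)) (x : S → Fin 2) (z : {i // i ∉ S} → Fin 2) :
    Fin n → Fin 2 :=
  fun i => if h : i ∈ S then x ⟨i, h⟩ else z ⟨i, h⟩

/-- The reduced state `ρ_S`: the partial trace over the qubits outside `S`. -/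
def reduced {n : ℕ} (S : Finset (Fin n)) (ρ : Op (Fin n)) : Op S :=
  fun x y => ∑ z : {i // i ∉ S} → Fin 2, ρ (glue S x z) (glue S y z)

/-- The trace norm `‖A‖₁`: the sum of the singular values of `A`. -/
def traceNorm {m : Type} [Fintype m] [DecidableEq m] (A : Matrix m m ℂ) : ℝ :=
  ∑ i, Real.sqrt ((Matrix.isHermitian_conjTranspose_mul_self A).eigenvalues i)

/-- The squared trace distance `‖ρ_S - 𝟙 / 2^|S|‖₁²` of the reduced state to the maximally mixed
state. -/
def scramblingError {n : ℕ} (S : Finset (Fin n)) (ρ : Op (Fin n)) : ℝ :=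
  traceNorm (reduced S ρ - ((1 : ℂ) / 2 ^ S.card) • (1 : Op S)) ^ 2

/-- The binary entropy function, with logarithms to base 2. -/
def entropy (x : ℝ) : ℝ := -x * Real.logb 2 x - (1 - x) * Real.logb 2 (1 - x)

end

end RQC

namespace RQC

noncomputable section

/-! ### The weight chain -/

/-- The probability that a random gate increases the weight of a Pauli string of weight `l`. -/
def upRate (n l : ℕ) : ℝ := 6 / 5 * l * (n - l) / (n * (n - 1))

/-- The probability that a random gate decreases the weight of a Pauli string of weight `l`. -/
def downRate (n l : ℕ) : ℝ := 2 / 5 * l * (l - 1) / (n * (n - 1))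

/-- The transition operator of the weight of a Pauli string under random gates. -/
def weightOp (n : ℕ) (h : ℕ → ℝ) (l : ℕ) : ℝ :=
  h l + upRate n l * (h (l + 1) - h l) + downRate n l * (h (l - 1) - h l)

theorem upRate_nonneg {n l : ℕ} (hn : 2 ≤ n) (hl : l ≤ n) : 0 ≤ upRate n l := by
  have h1 : (2 : ℝ) ≤ n := by exact_mod_cast hn
  have h2 : (l : ℝ) ≤ n := by exact_mod_cast hl
  have h3 : (0 : ℝ) ≤ n - l := by linarith
  have h4 : (0 : ℝ) < n * (n - 1) := by nlinarith
  unfold upRate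
  positivity

theorem downRate_nonneg {n l : ℕ} (hn : 2 ≤ n) : 0 ≤ downRate n l := by
  have h1 : (2 : ℝ) ≤ n := by exact_mod_cast hn
  have h4 : (0 : ℝ) < n * (n - 1) := by nlinarith
  unfold downRate
  rcases Nat.eq_zero_or_pos l with rfl | h
  · simp
  · have : (0 : ℝ) ≤ (l : ℝ) - 1 := by
      have : (1 : ℝ) ≤ l := by exact_mod_cast h
      linarith
    positivity

theorem upRate_add_downRate_le {n l : ℕ} (hn : 2 ≤ n) :
    upRate n l + downRate n l ≤ 1 := by
  have h1 : (2 : ℝ) ≤ n := by exact_mod_cast hn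
  have h3 : (0 : ℝ) ≤ l := Nat.cast_nonneg l
  have h4 : (0 : ℝ) < n * (n - 1) := by nlinarith
  unfold upRate downRate
  rw [← add_div, div_le_one h4]
  nlinarith [sq_nonneg ((l : ℝ) - 3 * n / 4)]

theorem weightOp_mono {n l : ℕ} (hn : 2 ≤ n) (hl : l ≤ n) {h h' : ℕ → ℝ} (h0 : h l ≤ h' l)
    (hd : 2 ≤ l → h (l - 1) ≤ h' (l - 1)) (hu : 1 ≤ l → l < n → h (l + 1) ≤ h' (l + 1)) :
    weightOp n h l ≤ weightOp n h' l := by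
  have e1 : upRate n l * (h (l + 1)) ≤ upRate n l * (h' (l + 1)) := by
    by_cases hc : 1 ≤ l ∧ l < n
    · exact mul_le_mul_of_nonneg_left (hu hc.1 hc.2) (upRate_nonneg hn hl)
    · have : upRate n l = 0 := by
        rcases Nat.eq_zero_or_pos l with rfl | h
        · simp [upRate]
        · have : l = n := by omega
          simp [upRate, this]
      simp [this]
  have e2 : downRate n l * (h (l - 1)) ≤ downRate n l * (h' (l - 1)) := by
    by_cases hc : 2 ≤ l
    · exact mul_le_mul_of_nonneg_left (hd hc) (downRate_nonneg hn)
    · have : downRate n l = 0 := by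
        have : l = 0 ∨ l = 1 := by omega
        rcases this with rfl | rfl <;> simp [downRate]
      simp [this]
  have e3 : (1 - (upRate n l + downRate n l)) * h l ≤ (1 - (upRate n l + downRate n l)) * h' l :=
    mul_le_mul_of_nonneg_left h0 (by linarith [upRate_add_downRate_le (l := l) hn])
  unfold weightOp
  nlinarith

theorem weightOp_const (n l : ℕ) (c : ℝ) : weightOp n (fun _ => c) l = c := by
  simp [weightOp]

theorem weightOp_add (n l : ℕ) (h h' : ℕ → ℝ) :
    weightOp n (fun k => h k + h' k) l = weightOp n h l + weightOp n h' l := by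
  simp only [weightOp]; ring

theorem weightOp_const_mul (n l : ℕ) (c : ℝ) (h : ℕ → ℝ) :
    weightOp n (fun k => c * h k) l = c * weightOp n h l := by
  simp only [weightOp]; ring

theorem weightOp_zero (n : ℕ) (h : ℕ → ℝ) : weightOp n h 0 = h 0 := by
  simp [weightOp, upRate, downRate]

/-- The number of Pauli strings of weight `l` on `n` qubits. -/
def paulis (n l : ℕ) : ℝ := 3 ^ l * n.choose l

theorem paulis_mul_upRate {n l : ℕ} (hl : l < n) :
    paulis n l * upRate n l = paulis n (l + 1) * downRate n (l + 1) := by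
  have h : ((n.choose (l + 1) : ℕ) : ℝ) * (l + 1) = n.choose l * (n - l) := by
    have := Nat.choose_succ_right_eq n l
    rw [← Nat.cast_sub hl.le]
    exact_mod_cast this
  unfold paulis upRate downRate
  push_cast
  rw [pow_succ]
  linear_combination (-(3 ^ l * (6 / 5) * l / (n * (n - 1)) : ℝ)) * h

theorem sum_paulis_mul_weightOp (n : ℕ) (h : ℕ → ℝ) :
    ∑ l ∈ Finset.range (n + 1), paulis n l * weightOp n h l =
      ∑ l ∈ Finset.range (n + 1), paulis n l * h l := by
  have e1 : ∑ l ∈ Finset.range (n + 1), paulis n l * upRate n l * (h (l + 1) - h l) =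
      ∑ l ∈ Finset.range n, paulis n l * upRate n l * (h (l + 1) - h l) := by
    rw [Finset.sum_range_succ]
    simp [upRate]
  have e2 : ∑ l ∈ Finset.range (n + 1), paulis n l * downRate n l * (h (l - 1) - h l) =
      ∑ l ∈ Finset.range n, paulis n l * upRate n l * (h l - h (l + 1)) := by
    rw [Finset.sum_range_succ']
    simp only [downRate, Nat.cast_zero, mul_zero, zero_mul, zero_div, add_zero]
    refine Finset.sum_congr rfl fun l hl => ?_
    rw [paulis_mul_upRate (Finset.mem_range.mp hl)]
    simp [downRate]
  have e3 : ∀ l, paulis n l * weightOp n h l = paulis n l * h l +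
      paulis n l * upRate n l * (h (l + 1) - h l) +
      paulis n l * downRate n l * (h (l - 1) - h l) := by
    intro l; unfold weightOp; ring
  simp only [e3, Finset.sum_add_distrib]
  rw [e1, e2, add_assoc, ← Finset.sum_add_distrib]
  simp only [add_eq_left]
  exact Finset.sum_eq_zero fun l _ => by ring

/-- The probability that the weight chain started at `l` has weight in `[1, s]` at time `t`. -/
def lowProb (n s t : ℕ) : ℕ → ℝ :=
  (weightOp n)^[t] fun l => if 1 ≤ l ∧ l ≤ s then 1 else 0

theorem lowProb_succ (n s t : ℕ) : lowProb n s (t + 1) = weightOp n (lowProb n s t) :=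
  Function.iterate_succ_apply' _ _ _

theorem lowProb_at_zero (n s t : ℕ) : lowProb n s t 0 = 0 := by
  induction t with
  | zero => simp [lowProb]
  | succ t ih => rw [lowProb_succ, weightOp_zero, ih]

theorem lowProb_nonneg {n : ℕ} (hn : 2 ≤ n) (s t : ℕ) : ∀ l ≤ n, 0 ≤ lowProb n s t l := by
  induction t with
  | zero => intro l _; simp only [lowProb, Function.iterate_zero, id]; split_ifs <;> norm_num
  | succ t ih =>
    intro l hl
    rw [lowProb_succ, ← weightOp_const n l 0]
    exact weightOp_mono hn hl (ih l hl) (fun _ => ih _ (by omega)) (fun _ _ => ih _ (by omega))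

theorem paulis_mul_lowProb_le {n m s : ℕ} (hn : 2 ≤ n) (hm : m ≤ n) (hs : s ≤ n) (t : ℕ) :
    paulis n m * lowProb n s t m ≤ ∑ k ∈ Finset.range (s + 1), paulis n k := by
  have hinv : ∑ l ∈ Finset.range (n + 1), paulis n l * lowProb n s t l ≤
      ∑ k ∈ Finset.range (s + 1), paulis n k := by
    induction t with
    | zero =>
      have hsub : Finset.range (s + 1) ⊆ Finset.range (n + 1) :=
        Finset.range_subset_range.mpr (by omega)
      rw [← Finset.sum_subset hsub]
      · refine Finset.sum_le_sum fun l _ => ?_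
        have : 0 ≤ paulis n l := by unfold paulis; positivity
        simp only [lowProb, Function.iterate_zero, id]
        split_ifs <;> simp [this]
      · intro l _ hl
        have : ¬ (1 ≤ l ∧ l ≤ s) := by simp at hl; omega
        simp [lowProb, this]
    | succ t ih => rw [lowProb_succ, sum_paulis_mul_weightOp]; exact ih
  refine le_trans ?_ hinv
  exact Finset.single_le_sum (f := fun l => paulis n l * lowProb n s t l)
    (fun l hl => mul_nonneg (by unfold paulis; positivity)
      (lowProb_nonneg hn s t l (by simp at hl; omega))) (Finset.mem_range.mpr (by omega))

theorem lowProb_le_of_le {n m s : ℕ} (hn : 2 ≤ n) (hm : m ≤ n) (hs : s < m) (t : ℕ) :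
    ∀ l, m ≤ l → l ≤ n →
      lowProb n s t l ≤ (∑ k ∈ Finset.range (s + 1), paulis n k) / paulis n m := by
  have hpos : 0 < paulis n m := by
    have := Nat.choose_pos hm
    unfold paulis; positivity
  have hε : 0 ≤ (∑ k ∈ Finset.range (s + 1), paulis n k) / paulis n m :=
    div_nonneg (Finset.sum_nonneg fun k _ => by unfold paulis; positivity) hpos.le
  have hmm : ∀ t, lowProb n s t m ≤
      (∑ k ∈ Finset.range (s + 1), paulis n k) / paulis n m := fun t => by
    rw [le_div_iff₀ hpos, mul_comm]
    exact paulis_mul_lowProb_le hn hm (by omega) t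
  induction t with
  | zero =>
    intro l hl _
    have : ¬ (1 ≤ l ∧ l ≤ s) := by omega
    simpa [lowProb, this] using hε
  | succ t ih =>
    intro l hl hln
    rcases hl.eq_or_lt with rfl | hlt
    · exact hmm _
    · rw [lowProb_succ]
      refine le_trans (weightOp_mono hn hln (ih l hl hln) (fun _ => ih _ (by omega) (by omega))
        (fun _ _ => ih _ (by omega) (by omega))) (weightOp_const n l _).le

/-- The probability that the weight chain started at `l` stays in `[1, m)` up to time `t`. -/
def survival (n m : ℕ) : ℕ → ℕ → ℝ
  | 0, l => if 1 ≤ l ∧ l < m then 1 else 0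
  | t + 1, l => if 1 ≤ l ∧ l < m then weightOp n (survival n m t) l else 0

theorem survival_of_not {n m t l : ℕ} (h : ¬ (1 ≤ l ∧ l < m)) : survival n m t l = 0 := by
  cases t <;> simp [survival, h]

theorem survival_le_one {n m : ℕ} (hn : 2 ≤ n) (hm : m ≤ n) (t l : ℕ) : survival n m t l ≤ 1 := by
  induction t generalizing l with
  | zero => unfold survival; split_ifs <;> norm_num
  | succ t ih =>
    unfold survival
    split_ifs with h
    · exact le_trans (weightOp_mono hn (by omega) (ih _) (fun _ => ih _) (fun _ _ => ih _))
        (weightOp_const n l 1).le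
    · norm_num

theorem lowProb_le_add_survival {n m s : ℕ} (hn : 2 ≤ n) (hm : m ≤ n) (hs : s < m) (t : ℕ) :
    ∀ l ≤ n, lowProb n s t l ≤
      (∑ k ∈ Finset.range (s + 1), paulis n k) / paulis n m + survival n m t l := by
  have hpos : 0 < paulis n m := by
    have := Nat.choose_pos hm
    unfold paulis; positivity
  have hε : 0 ≤ (∑ k ∈ Finset.range (s + 1), paulis n k) / paulis n m :=
    div_nonneg (Finset.sum_nonneg fun k _ => by unfold paulis; positivity) hpos.le
  have hout : ∀ t l, l ≤ n → ¬ (1 ≤ l ∧ l < m) → lowProb n s t l ≤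
      (∑ k ∈ Finset.range (s + 1), paulis n k) / paulis n m + survival n m t l := by
    intro t l hl h
    rw [survival_of_not h, add_zero]
    rcases Nat.eq_zero_or_pos l with rfl | h'
    · rw [lowProb_at_zero]; exact hε
    · exact lowProb_le_of_le hn hm hs t l (by omega) hl
  induction t with
  | zero =>
    intro l hl
    by_cases h : 1 ≤ l ∧ l < m
    · simp only [lowProb, Function.iterate_zero, id, survival, h, and_self, if_true]
      split_ifs <;> linarith
    · exact hout 0 l hl h
  | succ t ih =>
    intro l hl
    by_cases h : 1 ≤ l ∧ l < m
    · rw [lowProb_succ]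
      simp only [survival, h, and_self, if_true]
      rw [← weightOp_const n l ((∑ k ∈ Finset.range (s + 1), paulis n k) / paulis n m),
        ← weightOp_add]
      exact weightOp_mono hn hl (ih l hl) (fun _ => ih _ (by omega)) (fun _ _ => ih _ (by omega))
    · exact hout _ l hl h

/-- The reciprocal of `2 ^ l * n.choose l`. -/
def decay (n l : ℕ) : ℝ := (2 ^ l * n.choose l : ℝ)⁻¹

theorem decay_pos {n l : ℕ} (h : l ≤ n) : 0 < decay n l := by
  have := Nat.choose_pos h
  unfold decay; positivity

theorem decay_succ {n l : ℕ} (h : l < n) :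
    decay n (l + 1) = decay n l * ((l + 1) / (2 * (n - l))) := by
  have h1 : ((n.choose (l + 1) : ℕ) : ℝ) * (l + 1) = n.choose l * (n - l) := by
    have := Nat.choose_succ_right_eq n l
    rw [← Nat.cast_sub h.le]
    exact_mod_cast this
  have h2 : (0 : ℝ) < n - l := by
    have : (l : ℝ) < n := by exact_mod_cast h
    linarith
  have h3 : (0 : ℝ) < n.choose l := by exact_mod_cast Nat.choose_pos h.le
  have h4 : (0 : ℝ) < n.choose (l + 1) := by exact_mod_cast Nat.choose_pos h
  unfold decay
  rw [pow_succ]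
  field_simp
  linear_combination (-1 : ℝ) * h1

theorem weightOp_decay_le {n l : ℕ} (hn : 52 ≤ n) (h1 : 1 ≤ l) (h2 : 2 * l ≤ n) :
    weightOp n (decay n) l ≤ (1 - l / (20 * n)) * decay n l := by
  obtain ⟨k, rfl⟩ : ∃ k, l = k + 1 := ⟨l - 1, by omega⟩
  have hd := decay_pos (n := n) (l := k + 1) (by omega)
  have hnr : (52 : ℝ) ≤ n := by exact_mod_cast hn
  have hlr : (2 : ℝ) * (k + 1) ≤ n := by exact_mod_cast h2
  have hk : (0 : ℝ) ≤ k := Nat.cast_nonneg k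
  have e1 : decay n (k + 1 + 1) = decay n (k + 1) * ((k + 2) / (2 * (n - (k + 1)))) := by
    rw [decay_succ (by omega)]; push_cast; ring
  have e2 : decay n k = decay n (k + 1) * (2 * (n - k) / (k + 1)) := by
    rw [decay_succ (n := n) (l := k) (by omega)]
    have : (n : ℝ) - k ≠ 0 := by linarith
    field_simp
  have hnk : (n : ℝ) - (k + 1) ≠ 0 := by linarith
  have hn1 : (n : ℝ) - 1 ≠ 0 := by linarith
  have hn0 : (n : ℝ) ≠ 0 := by linarith
  have key : weightOp n (decay n) (k + 1) = decay n (k + 1) *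
      (1 + (2 / 5) * (-(n * (k + 1)) + 3 / 2 * (k + 1) ^ 2 + 13 / 2 * (k + 1) - 2 * n - 2) /
        (n * (n - 1))) := by
    unfold weightOp upRate downRate
    rw [Nat.add_sub_cancel, e1, e2]
    push_cast
    field_simp
    ring
  rw [key, mul_comm]
  refine mul_le_mul_of_nonneg_right ?_ hd.le
  have hpos : (0 : ℝ) < n * (n - 1) := by nlinarith
  have : (2 / 5) * (-((n : ℝ) * (k + 1)) + 3 / 2 * (k + 1) ^ 2 + 13 / 2 * (k + 1) - 2 * n - 2) /
        (n * (n - 1)) ≤ - ((k + 1) / (20 * n)) := by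
    rw [div_le_iff₀ hpos]
    have : -(((k : ℝ) + 1) / (20 * n)) * (n * (n - 1)) = -((k + 1) * (n - 1) / 20) := by
      field_simp
    rw [this]
    nlinarith
  push_cast
  linarith

/-- If the potential is large whenever the weight is below a fixed fraction of the accumulated
weight, and whenever the accumulated weight is large, then survival is unlikely. -/
theorem survival_le {n m : ℕ} (hn : 52 ≤ n) (hm : 2 * m ≤ n) {K κ Smax : ℝ} (hK : 0 < K)
    (hκ : 0 < κ)
    (hlow : ∀ l : ℕ, 1 ≤ l → l < m → ∀ S : ℝ, l ≤ κ * S →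
      K ≤ Real.exp (S / (20 * n)) * decay n l)
    (hmax : ∀ l : ℕ, 1 ≤ l → l < m → ∀ S : ℝ, Smax ≤ S →
      K ≤ Real.exp (S / (20 * n)) * decay n l) (t l : ℕ) (hl : l ≤ n) :
    ∀ S : ℝ, Smax ≤ (1 + κ) ^ t * S →
      survival n m t l ≤ Real.exp (S / (20 * n)) * decay n l / K := by
  have hn0 : (0 : ℝ) < n := by have : (52 : ℝ) ≤ n := by exact_mod_cast hn
                               linarith
  induction t generalizing l with
  | zero =>
    intro S hS
    by_cases h : 1 ≤ l ∧ l < m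
    · simp only [survival, h, and_self, if_true]
      rw [one_le_div hK]
      exact hmax l h.1 h.2 S (by simpa using hS)
    · rw [survival_of_not h]
      have := decay_pos hl
      positivity
  | succ t ih =>
    intro S hS
    by_cases h : 1 ≤ l ∧ l < m
    · by_cases hc : (l : ℝ) ≤ κ * S
      · refine le_trans (survival_le_one (by omega) (by omega) _ _) ?_
        rw [one_le_div hK]
        exact hlow l h.1 h.2 S hc
      · push Not at hc
        have hS' : Smax ≤ (1 + κ) ^ t * (S + l) := by
          refine hS.trans ?_
          rw [pow_succ, mul_assoc]
          refine mul_le_mul_of_nonneg_left ?_ (by positivity)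
          linarith
        simp only [survival, h, and_self, if_true]
        have hstep : weightOp n (survival n m t) l ≤
            weightOp n (fun k => Real.exp ((S + l) / (20 * n)) / K * decay n k) l := by
          refine weightOp_mono (by omega) hl ?_ (fun _ => ?_) (fun _ _ => ?_)
          · exact (ih _ hl _ hS').trans_eq (by ring)
          · exact (ih _ (by omega) _ hS').trans_eq (by ring)
          · exact (ih _ (by omega) _ hS').trans_eq (by ring)
        refine hstep.trans ?_
        rw [weightOp_const_mul]
        have h3 : 1 - (l : ℝ) / (20 * n) ≤ Real.exp (-(l / (20 * n))) := by
          have := Real.add_one_le_exp (-((l : ℝ) / (20 * n)))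
          linarith
        have hd := decay_pos hl
        calc Real.exp ((S + l) / (20 * n)) / K * weightOp n (decay n) l
            ≤ Real.exp ((S + l) / (20 * n)) / K * ((1 - l / (20 * n)) * decay n l) :=
              mul_le_mul_of_nonneg_left (weightOp_decay_le hn h.1 (by omega)) (by positivity)
          _ ≤ Real.exp ((S + l) / (20 * n)) / K * (Real.exp (-(l / (20 * n))) * decay n l) := by
              gcongr
          _ = Real.exp (S / (20 * n)) * decay n l / K := by
              have : Real.exp (S / (20 * n)) = Real.exp ((S + l) / (20 * n)) *
                  Real.exp (-(l / (20 * n))) := by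
                rw [← Real.exp_add]; congr 1; ring
              rw [this]; ring
    · rw [survival_of_not h]
      have := decay_pos hl
      positivity

/-! ### Random pairs and random sequences -/

theorem sum_pair_add_swap {n : ℕ} (F : Fin n → Fin n → ℝ) :
    ∑ p : Pair n, (F p.1.1 p.1.2 + F p.1.2 p.1.1) = ∑ i, ∑ j, if i ≠ j then F i j else 0 := by
  have h1 : ∀ F : Fin n → Fin n → ℝ, ∑ p : Pair n, F p.1.1 p.1.2 =
      ∑ i, ∑ j, if i < j then F i j else 0 := by
    intro F
    rw [← Fintype.sum_prod_type' (f := fun i j => if i < j then F i j else 0),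
      ← Finset.sum_filter]
    exact (Finset.sum_subtype _ (p := fun p : Fin n × Fin n => p.1 < p.2) (by simp)
      (fun p => F p.1 p.2)).symm
  rw [Finset.sum_add_distrib, h1, h1 (fun i j => F j i)]
  rw [Finset.sum_comm (f := fun i j => if i < j then F j i else 0), ← Finset.sum_add_distrib]
  refine Finset.sum_congr rfl fun i _ => ?_
  rw [← Finset.sum_add_distrib]
  refine Finset.sum_congr rfl fun j _ => ?_
  rcases lt_trichotomy i j with h | h | h
  · simp [h, h.ne, h.le]
  · simp [h]
  · simp [h, h.ne', h.le]

theorem card_pair (n : ℕ) : (Fintype.card (Pair n) : ℝ) = n * (n - 1) / 2 := by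
  have h := sum_pair_add_swap (n := n) (fun _ _ => 1)
  have h2 : ∀ i : Fin n, ∑ j : Fin n, (if i ≠ j then (1 : ℝ) else 0) = n - 1 := by
    intro i
    have : ∀ j : Fin n, (if i ≠ j then (1 : ℝ) else 0) = 1 - if i = j then 1 else 0 := by
      intro j; split_ifs <;> simp_all
    simp only [this, Finset.sum_sub_distrib]
    simp
  simp only [h2] at h
  simp at h
  linarith

theorem nonempty_pair {n : ℕ} (hn : 2 ≤ n) : Nonempty (Pair n) :=
  ⟨⟨(⟨0, by omega⟩, ⟨1, by omega⟩), by simp⟩⟩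

theorem lintegral_uniformOn_pair {n : ℕ} (hn : 2 ≤ n) (F : Pair n → ℝ) (hF : ∀ p, 0 ≤ F p) :
    ∫⁻ p, ENNReal.ofReal (F p) ∂(uniformOn (Set.univ : Set (Pair n))) =
      ENNReal.ofReal (2 / (n * (n - 1)) * ∑ p, F p) := by
  have := nonempty_pair hn
  have hc : (0 : ℝ) < Fintype.card (Pair n) := by exact_mod_cast Fintype.card_pos
  rw [uniformOn, ProbabilityTheory.cond, lintegral_smul_measure, Measure.restrict_univ, lintegral_count,
    tsum_fintype, ← ENNReal.ofReal_sum_of_nonneg fun p _ => hF p,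
    ENNReal.ofReal_mul (by
      have h2 : (2 : ℝ) ≤ n := by exact_mod_cast hn
      have : (0 : ℝ) < n * (n - 1) := by nlinarith
      positivity)]
  have : (2 : ℝ) / (n * (n - 1)) = (Fintype.card (Pair n) : ℝ)⁻¹ := by
    rw [card_pair]; simp
  rw [this, ENNReal.ofReal_inv_of_pos hc, ENNReal.ofReal_natCast, smul_eq_mul]
  congr 2
  rw [Measure.count_apply MeasurableSet.univ]
  simp

theorem measurable_foldl_ofFn {γ X : Type*} [MeasurableSpace γ] [MeasurableSpace X]
    {step : X → γ → X} (hstep : Measurable fun q : X × γ => step q.1 q.2) (t : ℕ) :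
    Measurable fun q : X × (Fin t → γ) => (List.ofFn q.2).foldl step q.1 := by
  induction t with
  | zero => simpa using measurable_fst
  | succ t ih =>
    simp only [List.ofFn_succ, List.foldl_cons]
    have h1 : Measurable fun q : X × (Fin (t + 1) → γ) => step q.1 (q.2 0) :=
      hstep.comp (measurable_fst.prodMk ((measurable_pi_apply 0).comp measurable_snd))
    have h2 : Measurable fun q : X × (Fin (t + 1) → γ) => fun i : Fin t => q.2 i.succ :=
      measurable_pi_lambda _ fun i => (measurable_pi_apply i.succ).comp measurable_snd
    exact ih.comp (h1.prodMk h2)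

/-- Supermartingale bound for the expectation of a function of a Markov chain that is driven by
independent identically distributed inputs. -/
theorem lintegral_pi_foldl_le {γ X : Type*} [MeasurableSpace γ] [MeasurableSpace X]
    (μ : Measure γ) [SigmaFinite μ]
    {step : X → γ → X} (hstep : Measurable fun q : X × γ => step q.1 q.2)
    {Φ : X → ℝ≥0∞} (hΦ : Measurable Φ) {U : ℕ → X → ℝ≥0∞} (h0 : ∀ x, Φ x ≤ U 0 x)
    (hU : ∀ t x, ∫⁻ g, U t (step x g) ∂μ ≤ U (t + 1) x) (t : ℕ) (x : X) :
    ∫⁻ ω : Fin t → γ, Φ ((List.ofFn ω).foldl step x) ∂(Measure.pi fun _ => μ) ≤ U t x := by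
  induction t generalizing x with
  | zero => simpa [Measure.pi_of_empty] using h0 x
  | succ t ih =>
    have hmp := measurePreserving_piFinSuccAbove (fun _ : Fin (t + 1) => μ) 0
    rw [← hmp.symm.lintegral_comp_emb (MeasurableEquiv.measurableEmbedding _),
      lintegral_prod _ ?_]
    · refine le_trans (lintegral_mono fun g => ?_) (hU t x)
      refine le_trans (lintegral_mono fun ω => ?_) (ih (step x g))
      simp [MeasurableEquiv.piFinSuccAbove, Fin.insertNthEquiv, List.ofFn_succ]
    · refine Measurable.aemeasurable ?_
      have h1 := (measurable_foldl_ofFn hstep (t + 1)).comp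
        (measurable_const (a := x) |>.prodMk (MeasurableEquiv.measurable
          (MeasurableEquiv.piFinSuccAbove (fun _ : Fin (t + 1) => γ) 0).symm))
      exact hΦ.comp h1

/-! ### The depth of the parallelized circuit -/

/-- The layers that the qubits reach, updated by a gate on the pair `p`. -/
def bump {n : ℕ} (D : Fin n → ℕ) (p : Pair n) : Fin n → ℕ :=
  fun q => if q = p.1.1 ∨ q = p.1.2 then 1 + max (D p.1.1) (D p.1.2) else D q

theorem le_bump {n : ℕ} (D : Fin n → ℕ) (p : Pair n) (q : Fin n) : D q ≤ bump D p q := by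
  unfold bump
  split_ifs with h
  · rcases h with rfl | rfl <;> omega
  · exact le_rfl

/-- The number of layers up to the last one in which the qubit `q` is touched. -/
def height {G : GateSet} {n : ℕ} (q : Fin n) : List (List (Gate G n)) → ℕ
  | [] => 0
  | L :: Ls => if ∃ h ∈ (L :: Ls).flatten, q ∈ Gate.qubits h then 1 + height q Ls else 0

theorem height_eq_zero {G : GateSet} {n : ℕ} {q : Fin n} {Ls : List (List (Gate G n))}
    (h : ∀ g ∈ Ls.flatten, q ∉ Gate.qubits g) : height q Ls = 0 := by
  cases Ls with
  | nil => rfl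
  | cons L Ls =>
    rw [height, if_neg]
    rintro ⟨g, hg, hq⟩
    exact h g hg hq

theorem mem_flatten_addGate {G : GateSet} {n : ℕ} (g h : Gate G n) (Ls : List (List (Gate G n))) :
    h ∈ (addGate g Ls).flatten ↔ h = g ∨ h ∈ Ls.flatten := by
  induction Ls with
  | nil => simp [addGate]
  | cons L Ls ih =>
    unfold addGate
    split_ifs with hd
    · simp only [List.flatten_cons, List.mem_append, List.mem_singleton]; tauto
    · rw [List.flatten_cons, List.mem_append, ih]
      simp only [List.flatten_cons, List.mem_append]; tauto

theorem height_cons_of_not_disjoint {G : GateSet} {n : ℕ} (g : Gate G n) (L : List (Gate G n))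
    (Ls : List (List (Gate G n)))
    (hd : ¬ ∀ h ∈ (L :: Ls).flatten, Disjoint (Gate.qubits g) (Gate.qubits h)) :
    1 + max (height g.1.1.1 Ls) (height g.1.1.2 Ls) ≤
      max (height g.1.1.1 (L :: Ls)) (height g.1.1.2 (L :: Ls)) := by
  have h0 : ∀ q : Fin n, (¬ ∃ h ∈ (L :: Ls).flatten, q ∈ Gate.qubits h) → height q Ls = 0 := by
    intro q hq
    refine height_eq_zero fun g hg hqg => hq ⟨g, ?_, hqg⟩
    rw [List.flatten_cons, List.mem_append]
    exact Or.inr hg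
  have hex : (∃ h ∈ (L :: Ls).flatten, g.1.1.1 ∈ Gate.qubits h) ∨
      (∃ h ∈ (L :: Ls).flatten, g.1.1.2 ∈ Gate.qubits h) := by
    push Not at hd
    obtain ⟨h, hh, hnd⟩ := hd
    rw [Finset.not_disjoint_iff] at hnd
    obtain ⟨q, hq, hq'⟩ := hnd
    simp only [Gate.qubits, Finset.mem_insert, Finset.mem_singleton] at hq
    rcases hq with rfl | rfl
    · exact Or.inl ⟨h, hh, hq'⟩
    · exact Or.inr ⟨h, hh, hq'⟩
  have h1 := h0 g.1.1.1
  have h2 := h0 g.1.1.2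
  rw [height, height]
  by_cases hA : ∃ h ∈ (L :: Ls).flatten, g.1.1.1 ∈ Gate.qubits h <;>
    by_cases hB : ∃ h ∈ (L :: Ls).flatten, g.1.1.2 ∈ Gate.qubits h
  · rw [if_pos hA, if_pos hB]; omega
  · rw [if_pos hA, if_neg hB, h2 hB]; omega
  · rw [if_neg hA, if_pos hB, h1 hA]; omega
  · exact absurd hex (not_or.mpr ⟨hA, hB⟩)

theorem height_addGate_le {G : GateSet} {n : ℕ} (g : Gate G n) (q : Fin n)
    (Ls : List (List (Gate G n))) :
    height q (addGate g Ls) ≤ bump (fun q => height q Ls) g.1 q := by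
  by_cases hq : q ∈ Gate.qubits g
  · have hq' : q = g.1.1.1 ∨ q = g.1.1.2 := by simpa [Gate.qubits] using hq
    simp only [bump, hq', if_true]
    induction Ls with
    | nil => simp [addGate, height, hq]
    | cons L Ls ih =>
      unfold addGate
      split_ifs with hd
      · have : height q Ls = 0 := height_eq_zero fun h hh hqh =>
          Finset.disjoint_left.mp (hd h (by
            rw [List.flatten_cons, List.mem_append]; exact Or.inr hh)) hq hqh
        rw [height, this]
        split_ifs <;> omega
      · have := height_cons_of_not_disjoint g L Ls hd
        rw [height]
        split_ifs <;> omega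
  · have hq' : ¬ (q = g.1.1.1 ∨ q = g.1.1.2) := by simpa [Gate.qubits] using hq
    simp only [bump, hq', if_false]
    induction Ls with
    | nil => simp [addGate, height, hq]
    | cons L Ls ih =>
      have hiff : (∃ h ∈ (addGate g (L :: Ls)).flatten, q ∈ Gate.qubits h) ↔
          ∃ h ∈ (L :: Ls).flatten, q ∈ Gate.qubits h := by
        constructor
        · rintro ⟨h, hh, hqh⟩
          rcases (mem_flatten_addGate _ _ _).mp hh with rfl | hh
          · exact absurd hqh hq
          · exact ⟨h, hh, hqh⟩
        · rintro ⟨h, hh, hqh⟩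
          exact ⟨h, (mem_flatten_addGate _ _ _).mpr (Or.inr hh), hqh⟩
      by_cases hd : ∀ h ∈ (L :: Ls).flatten, Disjoint (Gate.qubits g) (Gate.qubits h)
      · have e : addGate g (L :: Ls) = (L ++ [g]) :: Ls := by rw [addGate, if_pos hd]
        rw [e] at hiff ⊢
        rw [height, height]
        simp only [hiff]
        exact le_rfl
      · have e : addGate g (L :: Ls) = L :: addGate g Ls := by rw [addGate, if_neg hd]
        rw [e] at hiff ⊢
        rw [height, height]
        simp only [hiff]
        split_ifs <;> omega

theorem length_addGate_le {G : GateSet} {n : ℕ} (g : Gate G n) (Ls : List (List (Gate G n))) :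
    (addGate g Ls).length ≤
      max Ls.length (1 + max (height g.1.1.1 Ls) (height g.1.1.2 Ls)) := by
  induction Ls with
  | nil => simp [addGate]
  | cons L Ls ih =>
    unfold addGate
    split_ifs with hd
    · simp
    · have := height_cons_of_not_disjoint g L Ls hd
      simp only [List.length_cons]
      omega

theorem bump_mono {n : ℕ} {D D' : Fin n → ℕ} (h : ∀ q, D q ≤ D' q) (p : Pair n) (q : Fin n) :
    bump D p q ≤ bump D' p q := by
  unfold bump
  have := h p.1.1
  have := h p.1.2
  have := h q
  split_ifs <;> omega

theorem exists_length_foldl_le {G : GateSet} {n : ℕ} (gs : List (Gate G n)) :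
    ∀ (Ls : List (List (Gate G n))) (D : Fin n → ℕ), (∀ q, height q Ls ≤ D q) →
      (∃ q, Ls.length ≤ D q) →
      ∃ q, (gs.foldl (fun Ls g => addGate g Ls) Ls).length ≤
        gs.foldl (fun D g => bump D g.1) D q := by
  induction gs with
  | nil => intro Ls D _ h; exact h
  | cons g gs ih =>
    intro Ls D hD hlen
    simp only [List.foldl_cons]
    refine ih _ _ (fun q => (height_addGate_le g q Ls).trans (bump_mono hD _ _)) ?_
    obtain ⟨q, hq⟩ := hlen
    have h1 := length_addGate_le g Ls
    rcases le_total Ls.length (1 + max (height g.1.1.1 Ls) (height g.1.1.2 Ls)) with h | h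
    · refine ⟨g.1.1.1, ?_⟩
      have := hD g.1.1.1
      have := hD g.1.1.2
      simp only [bump, true_or, if_true]
      omega
    · exact ⟨q, (h1.trans (by omega)).trans (hq.trans (le_bump _ _ _))⟩

/-- The exponential potential of the layers that the qubits reach. -/
def depthPotential {n : ℕ} (D : Fin n → ℕ) : ℝ := ∑ q, 2 ^ D q

theorem two_pow_depth_le {G : GateSet} {n t : ℕ} (hn : 0 < n) (ω : Fin t → Gate G n) :
    (2 : ℝ) ^ depth ω ≤
      depthPotential ((List.ofFn ω).foldl (fun D g => bump D g.1) fun _ => 0) := by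
  obtain ⟨q, hq⟩ := exists_length_foldl_le (List.ofFn ω) [] (fun _ => 0) (fun q => by simp [height])
    ⟨⟨0, hn⟩, by simp⟩
  calc (2 : ℝ) ^ depth ω ≤ 2 ^ ((List.ofFn ω).foldl (fun D g => bump D g.1) (fun _ => 0) q) :=
        pow_le_pow_right₀ (by norm_num) hq
    _ ≤ _ := Finset.single_le_sum (f := fun q =>
        (2 : ℝ) ^ ((List.ofFn ω).foldl (fun D g => bump D g.1) (fun _ => 0) q))
        (fun _ _ => by positivity) (Finset.mem_univ q)

theorem depthPotential_bump_le {n : ℕ} (D : Fin n → ℕ) (p : Pair n) :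
    depthPotential (bump D p) ≤ depthPotential D + 4 * (2 ^ D p.1.1 + 2 ^ D p.1.2) := by
  have hmax : (2 : ℝ) ^ (1 + max (D p.1.1) (D p.1.2)) ≤ 2 * (2 ^ D p.1.1 + 2 ^ D p.1.2) := by
    rw [pow_add, pow_one]
    refine mul_le_mul_of_nonneg_left ?_ (by norm_num)
    have h1 : (0 : ℝ) < 2 ^ D p.1.1 := by positivity
    have h2 : (0 : ℝ) < 2 ^ D p.1.2 := by positivity
    rcases max_cases (D p.1.1) (D p.1.2) with h | h <;> rw [h.1] <;> linarith
  have hq : ∀ q, (2 : ℝ) ^ bump D p q ≤ 2 ^ D q +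
      ((if q = p.1.1 then 2 * (2 ^ D p.1.1 + 2 ^ D p.1.2) else 0) +
      (if q = p.1.2 then 2 * (2 ^ D p.1.1 + 2 ^ D p.1.2) else 0)) := by
    intro q
    have h0 : (0 : ℝ) < 2 ^ D q := by positivity
    have h1 : (0 : ℝ) < 2 * (2 ^ D p.1.1 + 2 ^ D p.1.2) := by positivity
    unfold bump
    split_ifs <;> first | linarith | tauto
  refine (Finset.sum_le_sum fun q _ => hq q).trans ?_
  rw [Finset.sum_add_distrib, Finset.sum_add_distrib]
  simp only [Finset.sum_ite_eq', Finset.mem_univ, if_true]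
  unfold depthPotential
  linarith

theorem sum_depthPotential_bump_le {n : ℕ} (hn : 2 ≤ n) (D : Fin n → ℕ) :
    2 / (n * (n - 1)) * ∑ p : Pair n, depthPotential (bump D p) ≤
      (1 + 8 / n) * depthPotential D := by
  have h2 : (2 : ℝ) ≤ n := by exact_mod_cast hn
  have hpos : (0 : ℝ) < n * (n - 1) := by nlinarith
  have hsum : ∑ p : Pair n, ((2 : ℝ) ^ D p.1.1 + 2 ^ D p.1.2) = (n - 1) * depthPotential D := by
    rw [sum_pair_add_swap (fun i _ => (2 : ℝ) ^ D i), depthPotential, Finset.mul_sum]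
    refine Finset.sum_congr rfl fun i _ => ?_
    have : ∀ j : Fin n, (if i ≠ j then (2 : ℝ) ^ D i else 0) =
        2 ^ D i - if i = j then 2 ^ D i else 0 := by
      intro j; split_ifs <;> simp_all
    simp only [this, Finset.sum_sub_distrib]
    simp
    ring
  have h3 : ∑ p : Pair n, depthPotential (bump D p) ≤
      n * (n - 1) / 2 * depthPotential D + 4 * ((n - 1) * depthPotential D) := by
    refine (Finset.sum_le_sum fun p _ => depthPotential_bump_le D p).trans ?_
    rw [Finset.sum_add_distrib, ← Finset.mul_sum, hsum, Finset.sum_const, nsmul_eq_mul,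
      Finset.card_univ, card_pair]
  refine (mul_le_mul_of_nonneg_left h3 (by positivity)).trans_eq ?_
  have : (n : ℝ) - 1 ≠ 0 := by linarith
  field_simp
  ring

theorem lintegral_two_pow_depth_le (G : GateSet) {n : ℕ} (hn : 2 ≤ n) (t : ℕ) :
    ∫⁻ ω, ENNReal.ofReal
        (depthPotential ((List.ofFn ω).foldl (fun D (g : Gate G n) => bump D g.1) fun _ => 0))
        ∂(circuitMeasure G n t) ≤ ENNReal.ofReal ((1 + 8 / n) ^ t * n) := by
  have hnn : ∀ D : Fin n → ℕ, 0 ≤ depthPotential D := fun D =>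
    Finset.sum_nonneg fun _ _ => by positivity
  have h := lintegral_pi_foldl_le ((uniformOn (Set.univ : Set (Pair n))).prod (gateMeasure G))
    (step := fun (D : Fin n → ℕ) (g : Gate G n) => bump D g.1)
    (by
      have : Measurable fun q : (Fin n → ℕ) × Pair n => bump q.1 q.2 := measurable_of_countable _
      exact this.comp (measurable_fst.prodMk (measurable_fst.comp measurable_snd)))
    (Φ := fun D => ENNReal.ofReal (depthPotential D)) (measurable_of_countable _)
    (U := fun t D => ENNReal.ofReal ((1 + 8 / n) ^ t * depthPotential D))
    (fun D => by simp)
    (fun t D => by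
      have := lintegral_prod (μ := uniformOn (Set.univ : Set (Pair n))) (ν := gateMeasure G)
        (fun g : Gate G n => ENNReal.ofReal ((1 + 8 / n) ^ t * depthPotential (bump D g.1)))
        (((measurable_of_countable fun p : Pair n =>
          ENNReal.ofReal ((1 + 8 / n) ^ t * depthPotential (bump D p))).comp
            measurable_fst).aemeasurable)
      rw [this]
      simp only [lintegral_const, measure_univ, mul_one]
      rw [lintegral_uniformOn_pair hn _ fun p => mul_nonneg (by positivity) (hnn _)]
      refine ENNReal.ofReal_le_ofReal ?_
      rw [← Finset.mul_sum, mul_left_comm, pow_succ, mul_assoc]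
      exact mul_le_mul_of_nonneg_left (sum_depthPotential_bump_le hn D) (by positivity))
    t (fun _ => 0)
  refine h.trans_eq ?_
  simp [depthPotential]

theorem circuitMeasure_depth_gt_le (G : GateSet) {n : ℕ} (hn : 2 ≤ n) (t : ℕ) (d : ℝ) :
    circuitMeasure G n t {ω | d < (depth ω : ℝ)} ≤
      ENNReal.ofReal ((1 + 8 / n) ^ t * n / (2 : ℝ) ^ d) := by
  have hpos : (0 : ℝ) < (2 : ℝ) ^ d := by positivity
  have hmeas : Measurable fun ω : Fin t → Gate G n => ENNReal.ofReal
      (depthPotential ((List.ofFn ω).foldl (fun D (g : Gate G n) => bump D g.1) fun _ => 0)) := by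
    have hstep : Measurable fun q : (Fin n → ℕ) × Gate G n => bump q.1 q.2.1 := by
      have : Measurable fun q : (Fin n → ℕ) × Pair n => bump q.1 q.2 := measurable_of_countable _
      exact this.comp (measurable_fst.prodMk (measurable_fst.comp measurable_snd))
    exact (measurable_of_countable fun D : Fin n → ℕ => ENNReal.ofReal (depthPotential D)).comp
      ((measurable_foldl_ofFn hstep t).comp (measurable_const.prodMk measurable_id))
  have hsub : {ω : Fin t → Gate G n | d < (depth ω : ℝ)} ⊆ {ω | ENNReal.ofReal ((2 : ℝ) ^ d) ≤
      ENNReal.ofReal (depthPotential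
        ((List.ofFn ω).foldl (fun D (g : Gate G n) => bump D g.1) fun _ => 0))} := by
    intro ω hω
    refine ENNReal.ofReal_le_ofReal (le_trans ?_ (two_pow_depth_le (by omega) ω))
    rw [← Real.rpow_natCast]
    exact Real.rpow_le_rpow_of_exponent_le (by norm_num) (le_of_lt hω)
  refine (measure_mono hsub).trans ?_
  refine (meas_ge_le_lintegral_div hmeas.aemeasurable (by simpa using hpos)
    ENNReal.ofReal_ne_top).trans ?_
  rw [ENNReal.ofReal_div_of_pos hpos]
  exact ENNReal.div_le_div_right (lintegral_two_pow_depth_le G hn t) _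

/-! ### Pauli strings -/

/-- The tensor product of the Pauli matrices `pauli (ν i)`. -/
def pauliString {ι : Type} [Fintype ι] (ν : ι → Fin 4) : Op ι :=
  fun x y => ∏ i, pauli (ν i) (x i) (y i)

/-- The squared modulus of a Pauli coefficient. -/
def coeffSq {ι : Type} [Fintype ι] [DecidableEq ι] (ν : ι → Fin 4) (A : Op ι) : ℝ :=
  ‖(pauliString ν * A).trace‖ ^ 2

theorem coeffSq_nonneg {ι : Type} [Fintype ι] [DecidableEq ι] (ν : ι → Fin 4) (A : Op ι) :
    0 ≤ coeffSq ν A := sq_nonneg _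

theorem pauli_zero : pauli 0 = 1 := by
  ext i j; fin_cases i <;> fin_cases j <;> simp [pauli]

theorem sum_pauli_mul_star (x y x' y' : Fin 2) :
    ∑ a, pauli a x y * star (pauli a x' y') = if x = x' ∧ y = y' then 2 else 0 := by
  rw [Fin.sum_univ_four]
  fin_cases x <;> fin_cases y <;> fin_cases x' <;> fin_cases y' <;> simp [pauli] <;> norm_num

theorem trace_mul_eq_sum {m : Type} [Fintype m] (A B : Matrix m m ℂ) :
    (A * B).trace = ∑ q : m × m, A q.1 q.2 * B q.2 q.1 := by
  rw [Fintype.sum_prod_type]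
  simp [Matrix.trace, Matrix.mul_apply]

theorem sum_pauliString_mul_star {ι : Type} [Fintype ι] [DecidableEq ι] (x y x' y' : ι → Fin 2) :
    ∑ ν : ι → Fin 4, pauliString ν x y * star (pauliString ν x' y') =
      if x = x' ∧ y = y' then 2 ^ Fintype.card ι else 0 := by
  simp only [pauliString, star_prod, ← Finset.prod_mul_distrib]
  have h := Finset.prod_univ_sum (fun _ : ι => (Finset.univ : Finset (Fin 4)))
    (fun i a => pauli a (x i) (y i) * star (pauli a (x' i) (y' i)))
  rw [Fintype.piFinset_univ] at h
  rw [← h]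
  simp only [sum_pauli_mul_star]
  rw [Finset.prod_ite_zero]
  have hiff : (∀ i ∈ Finset.univ, x i = x' i ∧ y i = y' i) ↔ (x = x' ∧ y = y') := by
    simp only [Finset.mem_univ, true_imp_iff, funext_iff, forall_and]
  simp only [hiff, Finset.prod_const, Finset.card_univ]

/-- Parseval's identity for a family of matrices that is complete and orthogonal. -/
theorem sum_norm_trace_mul_sq {κ m : Type} [Fintype κ] [Fintype m] [DecidableEq m]
    {P : κ → Matrix m m ℂ} {c : ℝ}
    (hP : ∀ x y x' y', ∑ a, P a x y * star (P a x' y') = if x = x' ∧ y = y' then (c : ℂ) else 0)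
    (A : Matrix m m ℂ) : ∑ a, ‖(P a * A).trace‖ ^ 2 = c * ∑ x, ∑ y, ‖A x y‖ ^ 2 := by
  have key : (∑ a, (P a * A).trace * star (P a * A).trace : ℂ) =
      ∑ q : m × m, c * (A q.2 q.1 * star (A q.2 q.1)) := by
    simp only [trace_mul_eq_sum, star_sum, Finset.sum_mul_sum, star_mul']
    rw [Finset.sum_comm]
    refine Finset.sum_congr rfl fun q _ => ?_
    rw [Finset.sum_comm]
    have : ∀ q' : m × m, ∑ a, P a q.1 q.2 * A q.2 q.1 *
        (star (P a q'.1 q'.2) * star (A q'.2 q'.1)) =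
        if q = q' then c * (A q.2 q.1 * star (A q'.2 q'.1)) else 0 := by
      intro q'
      have h1 : ∀ a, P a q.1 q.2 * A q.2 q.1 * (star (P a q'.1 q'.2) * star (A q'.2 q'.1)) =
          P a q.1 q.2 * star (P a q'.1 q'.2) * (A q.2 q.1 * star (A q'.2 q'.1)) :=
        fun a => by ring
      simp only [h1]
      rw [← Finset.sum_mul, hP]
      simp only [← Prod.ext_iff, ite_mul, zero_mul]
    simp only [this, Finset.sum_ite_eq, Finset.mem_univ, if_true]
  have h2 : ∀ z : ℂ, z * star z = ((‖z‖ ^ 2 : ℝ) : ℂ) := by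
    intro z
    rw [Complex.star_def, Complex.mul_conj, Complex.normSq_eq_norm_sq]
  simp only [h2] at key
  rw [Fintype.sum_prod_type, Finset.sum_comm] at key
  simp only [← Finset.mul_sum] at key
  exact_mod_cast key

/-- Parseval's identity for Pauli strings. -/
theorem sum_coeffSq {ι : Type} [Fintype ι] [DecidableEq ι] (A : Op ι) :
    ∑ ν : ι → Fin 4, coeffSq ν A = 2 ^ Fintype.card ι * ∑ x, ∑ y, ‖A x y‖ ^ 2 :=
  sum_norm_trace_mul_sq (fun x y x' y' => by rw [sum_pauliString_mul_star]; push_cast; rfl) A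

/-- The set of qubits on which a Pauli string acts nontrivially. -/
def supp {ι : Type} [Fintype ι] (ν : ι → Fin 4) : Finset ι := Finset.univ.filter fun i => ν i ≠ 0

/-- The Pauli string that is `ν` on `S` and the identity elsewhere. -/
def extend {n : ℕ} (S : Finset (Fin n)) (ν : S → Fin 4) : Fin n → Fin 4 :=
  fun i => if h : i ∈ S then ν ⟨i, h⟩ else 0

theorem sum_glue {n : ℕ} (S : Finset (Fin n)) (F : (Fin n → Fin 2) → ℂ) :
    ∑ x, F x = ∑ x : S → Fin 2, ∑ z : {i // i ∉ S} → Fin 2, F (glue S x z) := by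
  rw [← Fintype.sum_prod_type' (f := fun x z => F (glue S x z))]
  exact (Equiv.sum_comp (Equiv.piEquivPiSubtypeProd (fun i => i ∈ S) (fun _ => Fin 2)).symm F).symm

theorem pauliString_extend_glue {n : ℕ} (S : Finset (Fin n)) (ν : S → Fin 4)
    (x y : S → Fin 2) (z w : {i // i ∉ S} → Fin 2) :
    pauliString (extend S ν) (glue S x z) (glue S y w) =
      pauliString ν x y * if z = w then 1 else 0 := by
  unfold pauliString
  rw [← Fintype.prod_subtype_mul_prod_subtype (fun i => i ∈ S)]
  congr 1
  · exact Finset.prod_congr (by ext; simp) fun i _ => by simp [extend, glue]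
  · have : ∀ i : {i // i ∉ S}, pauli (extend S ν i) (glue S x z i) (glue S y w i) =
        if z i = w i then 1 else 0 := by
      intro i
      simp [extend, glue, i.2, pauli_zero, Matrix.one_apply]
    simp only [this]
    rw [Finset.prod_ite_zero]
    simp [funext_iff]

theorem trace_pauliString_extend {n : ℕ} (S : Finset (Fin n)) (ν : S → Fin 4) (ρ : Op (Fin n)) :
    (pauliString (extend S ν) * ρ).trace = (pauliString ν * reduced S ρ).trace := by
  rw [trace_mul_eq_sum, trace_mul_eq_sum, Fintype.sum_prod_type, Fintype.sum_prod_type, sum_glue S]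
  refine Finset.sum_congr rfl fun x _ => ?_
  simp only [sum_glue S]
  rw [Finset.sum_comm]
  refine Finset.sum_congr rfl fun y _ => ?_
  simp only [pauliString_extend_glue, mul_ite, mul_one, mul_zero, ite_mul, zero_mul,
    Finset.sum_ite_eq, Finset.mem_univ, if_true]
  rw [reduced, Finset.mul_sum]

theorem sum_supp_subset {n : ℕ} (S : Finset (Fin n)) (F : (Fin n → Fin 4) → ℝ) :
    ∑ ν ∈ Finset.univ.filter (fun ν : Fin n → Fin 4 => supp ν ⊆ S), F ν =
      ∑ ν : S → Fin 4, F (extend S ν) := by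
  symm
  refine Finset.sum_nbij' (extend S) (fun ν i => ν i) ?_ ?_ ?_ ?_ ?_
  · intro ν _
    simp only [Finset.mem_filter, Finset.mem_univ, true_and]
    intro i hi
    by_contra h
    simp [supp, extend, h] at hi
  · simp
  · intro ν _
    ext i
    simp [extend]
  · intro ν hν
    funext i
    simp only [extend]
    split_ifs with h
    · rfl
    · by_contra h'
      simp only [Finset.mem_filter, Finset.mem_univ, true_and] at hν
      exact h (hν (by simpa [supp] using Ne.symm h'))
  · simp

theorem sum_norm_sq_le {m : Type} [Fintype m] [DecidableEq m] {A : Matrix m m ℂ}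
    (hA : A.PosSemidef) (ht : A.trace = 1) : ∑ x, ∑ y, ‖A x y‖ ^ 2 ≤ 1 := by
  have hd : ∀ x, A x x = ((A x x).re : ℂ) := by
    intro x
    have := hA.1.apply x x
    rw [Complex.star_def] at this
    exact (Complex.conj_eq_iff_re.mp this).symm
  have hxy : ∀ x y, ‖A x y‖ ^ 2 ≤ (A x x).re * (A y y).re := by
    intro x y
    have h := (hA.submatrix ![x, y]).det_nonneg
    rw [Matrix.det_fin_two] at h
    simp only [Matrix.submatrix_apply, Matrix.cons_val_zero, Matrix.cons_val_one] at h
    rw [← hA.1.apply y x, Complex.star_def, Complex.mul_conj, Complex.normSq_eq_norm_sq,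
      hd x, hd y] at h
    norm_cast at h
    linarith
  have hsum : ∑ x, (A x x).re = 1 := by
    have := congrArg Complex.re ht
    simpa [Matrix.trace] using this
  calc ∑ x, ∑ y, ‖A x y‖ ^ 2 ≤ ∑ x, ∑ y, (A x x).re * (A y y).re :=
        Finset.sum_le_sum fun x _ => Finset.sum_le_sum fun y _ => hxy x y
    _ = 1 := by rw [← Finset.sum_mul_sum, hsum, one_mul]

theorem reduced_posSemidef {n : ℕ} (S : Finset (Fin n)) {ρ : Op (Fin n)} (hρ : ρ.PosSemidef) :
    (reduced S ρ).PosSemidef := by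
  have : reduced S ρ = ∑ z : {i // i ∉ S} → Fin 2, ρ.submatrix (fun x => glue S x z)
      (fun x => glue S x z) := by
    ext x y
    simp [reduced, Matrix.sum_apply]
  rw [this]
  exact Matrix.posSemidef_sum _ fun z _ => hρ.submatrix _

theorem trace_reduced {n : ℕ} (S : Finset (Fin n)) (ρ : Op (Fin n)) :
    (reduced S ρ).trace = ρ.trace := by
  simp only [Matrix.trace, Matrix.diag, reduced]
  exact (sum_glue S fun x => ρ x x).symm

theorem sum_coeffSq_supp_subset_le {n : ℕ} (S : Finset (Fin n)) {ρ : Op (Fin n)}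
    (hρ : ρ.PosSemidef) (ht : ρ.trace = 1) :
    ∑ ν ∈ Finset.univ.filter (fun ν : Fin n → Fin 4 => supp ν ⊆ S), coeffSq ν ρ ≤ 2 ^ S.card := by
  rw [sum_supp_subset]
  have : ∀ ν : S → Fin 4, coeffSq (extend S ν) ρ = coeffSq ν (reduced S ρ) := fun ν => by
    rw [coeffSq, trace_pauliString_extend, coeffSq]
  simp only [this]
  rw [sum_coeffSq, Fintype.card_coe]
  have h1 := sum_norm_sq_le (reduced_posSemidef S hρ) (by rw [trace_reduced, ht])
  have h2 : (0 : ℝ) < 2 ^ S.card := by positivity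
  nlinarith

theorem sum_coeffSq_le {n : ℕ} {ρ : Op (Fin n)} (hρ : ρ.PosSemidef) (ht : ρ.trace = 1) :
    ∑ ν : Fin n → Fin 4, coeffSq ν ρ ≤ 2 ^ n := by
  simpa using sum_coeffSq_supp_subset_le Finset.univ hρ ht

theorem sum_coeffSq_card_supp_le {n : ℕ} {ρ : Op (Fin n)} (hρ : ρ.PosSemidef) (ht : ρ.trace = 1)
    (l : ℕ) :
    ∑ ν ∈ Finset.univ.filter (fun ν : Fin n → Fin 4 => (supp ν).card = l), coeffSq ν ρ ≤
      2 ^ l * n.choose l := by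
  have hmaps : ∀ ν ∈ Finset.univ.filter (fun ν : Fin n → Fin 4 => (supp ν).card = l),
      supp ν ∈ Finset.powersetCard l (Finset.univ : Finset (Fin n)) := by
    intro ν hν
    rw [Finset.mem_powersetCard]
    exact ⟨Finset.subset_univ _, (Finset.mem_filter.mp hν).2⟩
  rw [← Finset.sum_fiberwise_of_maps_to hmaps]
  have hL : ∀ L ∈ Finset.powersetCard l (Finset.univ : Finset (Fin n)),
      ∑ ν ∈ (Finset.univ.filter (fun ν : Fin n → Fin 4 => (supp ν).card = l)).filter
        (fun ν => supp ν = L), coeffSq ν ρ ≤ 2 ^ l := by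
    intro L hL
    rw [← (Finset.mem_powersetCard.mp hL).2]
    refine le_trans (Finset.sum_le_sum_of_subset_of_nonneg ?_ fun ν _ _ => coeffSq_nonneg ν ρ)
      (sum_coeffSq_supp_subset_le L hρ ht)
    intro ν hν
    simp only [Finset.mem_filter, Finset.mem_univ, true_and] at hν ⊢
    exact hν.2.le
  refine (Finset.sum_le_sum hL).trans_eq ?_
  simp [mul_comm]

theorem traceNorm_sq_le {m : Type} [Fintype m] [DecidableEq m] (A : Matrix m m ℂ) :
    traceNorm A ^ 2 ≤ Fintype.card m * ∑ x, ∑ y, ‖A x y‖ ^ 2 := by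
  have hH := Matrix.isHermitian_conjTranspose_mul_self A
  have hnn : ∀ i, 0 ≤ hH.eigenvalues i :=
    (Matrix.posSemidef_conjTranspose_mul_self A).eigenvalues_nonneg
  have htr : ∑ i, hH.eigenvalues i = ∑ x, ∑ y, ‖A x y‖ ^ 2 := by
    have h := hH.trace_eq_sum_eigenvalues
    have h2 : (A.conjTranspose * A).trace = ((∑ x, ∑ y, ‖A x y‖ ^ 2 : ℝ) : ℂ) := by
      rw [Finset.sum_comm]
      simp only [Matrix.trace, Matrix.diag, Matrix.mul_apply, Matrix.conjTranspose_apply]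
      push_cast
      refine Finset.sum_congr rfl fun x _ => Finset.sum_congr rfl fun y _ => ?_
      rw [Complex.star_def, mul_comm, Complex.mul_conj, Complex.normSq_eq_norm_sq]
      push_cast; rfl
    rw [h2] at h
    apply Complex.ofReal_injective
    rw [h, Complex.ofReal_sum]
    rfl
  rw [← htr]
  unfold traceNorm
  refine (sq_sum_le_card_mul_sum_sq (s := Finset.univ)
    (f := fun i => Real.sqrt (hH.eigenvalues i))).trans_eq ?_
  simp only [Real.sq_sqrt (hnn _), Finset.card_univ]

theorem pauliString_zero {ι : Type} [Fintype ι] [DecidableEq ι] :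
    pauliString (0 : ι → Fin 4) = 1 := by
  ext x y
  simp only [pauliString, Pi.zero_apply, pauli_zero, Matrix.one_apply]
  rw [Finset.prod_ite_zero]
  simp [funext_iff]

theorem trace_pauli (a : Fin 4) : (pauli a).trace = if a = 0 then 2 else 0 := by
  fin_cases a <;> simp [pauli, Matrix.trace, Fin.sum_univ_two]
  norm_num

theorem trace_pauliString_of_ne_zero {ι : Type} [Fintype ι] [DecidableEq ι] {ν : ι → Fin 4}
    (h : ν ≠ 0) : (pauliString ν).trace = 0 := by
  have h1 : (pauliString ν).trace = ∏ i, (pauli (ν i)).trace := by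
    simp only [Matrix.trace, Matrix.diag, pauliString]
    have := Finset.prod_univ_sum (fun _ : ι => (Finset.univ : Finset (Fin 2)))
      (fun i a => pauli (ν i) a a)
    rw [Fintype.piFinset_univ] at this
    exact this.symm
  obtain ⟨i, hi⟩ := Function.ne_iff.mp h
  rw [h1]
  exact Finset.prod_eq_zero (Finset.mem_univ i) ((trace_pauli _).trans (if_neg hi))

/-- The scrambling error is bounded by the weight of the nontrivial Pauli coefficients on at most
`|S|` qubits. -/
theorem scramblingError_le {n : ℕ} (S : Finset (Fin n)) {ρ : Op (Fin n)} (ht : ρ.trace = 1) :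
    scramblingError S ρ ≤ ∑ ν : Fin n → Fin 4, coeffSq ν ρ *
      (if 1 ≤ (supp ν).card ∧ (supp ν).card ≤ S.card then 1 else 0) := by
  refine (traceNorm_sq_le _).trans ?_
  have hcard : (Fintype.card (S → Fin 2) : ℝ) = 2 ^ Fintype.card S := by simp
  rw [hcard, ← sum_coeffSq]
  have hle : ∀ ν : S → Fin 4, coeffSq ν (reduced S ρ - ((1 : ℂ) / 2 ^ S.card) • (1 : Op S)) ≤
      coeffSq (extend S ν) ρ * (if 1 ≤ (supp (extend S ν)).card ∧
        (supp (extend S ν)).card ≤ S.card then 1 else 0) := by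
    intro ν
    have hsub : supp (extend S ν) ⊆ S := by
      intro i hi
      by_contra h
      simp [supp, extend, h] at hi
    have hexp : (pauliString ν * (reduced S ρ - ((1 : ℂ) / 2 ^ S.card) • (1 : Op S))).trace =
        (pauliString (extend S ν) * ρ).trace -
          ((1 : ℂ) / 2 ^ S.card) * (pauliString ν).trace := by
      rw [trace_pauliString_extend, mul_sub, Matrix.trace_sub, Matrix.mul_smul, mul_one,
        Matrix.trace_smul, smul_eq_mul]
    by_cases h : ν = 0
    · have h0 : extend S ν = 0 := by
        funext i; simp [extend, h]
      have : coeffSq ν (reduced S ρ - ((1 : ℂ) / 2 ^ S.card) • (1 : Op S)) = 0 := by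
        rw [coeffSq, hexp, h0, h, pauliString_zero, pauliString_zero, one_mul, ht,
          Matrix.trace_one]
        simp
      rw [this]
      have := coeffSq_nonneg (extend S ν) ρ
      split_ifs <;> simp [this]
    · have h1 : 1 ≤ (supp (extend S ν)).card := by
        obtain ⟨i, hi⟩ := Function.ne_iff.mp h
        refine Finset.card_pos.mpr ⟨i, ?_⟩
        simpa [supp, extend] using hi
      rw [if_pos ⟨h1, Finset.card_le_card hsub⟩, mul_one, coeffSq, hexp,
        trace_pauliString_of_ne_zero h, mul_zero, sub_zero, coeffSq]
  refine (Finset.sum_le_sum fun ν _ => hle ν).trans ?_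
  rw [← sum_supp_subset S (fun ν => coeffSq ν ρ * (if 1 ≤ (supp ν).card ∧
    (supp ν).card ≤ S.card then 1 else 0))]
  refine Finset.sum_le_sum_of_subset_of_nonneg (Finset.subset_univ _) fun ν _ _ => ?_
  have := coeffSq_nonneg ν ρ
  split_ifs <;> simp [this]

/-! ### The second moment of a random two-qubit gate -/

/-- The two-qubit Pauli matrices. -/
def pauliPair (α : Fin 4 × Fin 4) : Matrix (Fin 2 × Fin 2) (Fin 2 × Fin 2) ℂ :=
  pauli α.1 ⊗ₖ pauli α.2

/-- Two Pauli matrices anticommute. -/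
def anti (a b : Fin 4) : Bool := a != 0 && (b != 0 && a != b)

/-- Two two-qubit Pauli matrices anticommute. -/
def antiPair (α β : Fin 4 × Fin 4) : Bool := xor (anti α.1 β.1) (anti α.2 β.2)

theorem pauli_mul_comm (a b : Fin 4) :
    pauli a * pauli b = (if anti a b then (-1 : ℂ) else 1) • (pauli b * pauli a) := by
  fin_cases a <;> fin_cases b <;> ext i j <;> fin_cases i <;> fin_cases j <;>
    simp [pauli, anti, Matrix.mul_apply, Fin.sum_univ_two]

theorem exists_pauli_mul (a b : Fin 4) :
    ∃ (k : ℕ) (c : Fin 4), pauli a * pauli b = Complex.I ^ k • pauli c := by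
  have h1 : pauli 1 * pauli 2 = Complex.I • pauli 3 := by
    ext i j; fin_cases i <;> fin_cases j <;> simp [pauli, Matrix.mul_apply, Fin.sum_univ_two]
  have h2 : pauli 2 * pauli 3 = Complex.I • pauli 1 := by
    ext i j; fin_cases i <;> fin_cases j <;> simp [pauli, Matrix.mul_apply, Fin.sum_univ_two]
  have h3 : pauli 3 * pauli 1 = Complex.I • pauli 2 := by
    ext i j; fin_cases i <;> fin_cases j <;> simp [pauli, Matrix.mul_apply, Fin.sum_univ_two]
  have hsq : ∀ a, pauli a * pauli a = 1 := by
    intro a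
    ext i j
    fin_cases a <;> fin_cases i <;> fin_cases j <;>
      simp [pauli, Matrix.mul_apply, Fin.sum_univ_two]
  have hI : Complex.I ^ 3 = -Complex.I := Complex.I_pow_three
  by_cases ha : a = 0
  · exact ⟨0, b, by simp [ha, pauli_zero]⟩
  by_cases hb : b = 0
  · exact ⟨0, a, by simp [hb, pauli_zero]⟩
  by_cases hab : a = b
  · exact ⟨0, 0, by simp [hab, pauli_zero, hsq]⟩
  have hanti : ∀ x y : Fin 4, anti x y = true → pauli x * pauli y = -(pauli y * pauli x) :=
    fun x y h => by rw [pauli_mul_comm x y, h]; simp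
  have hcases : (a = 1 ∧ b = 2) ∨ (a = 2 ∧ b = 3) ∨ (a = 3 ∧ b = 1) ∨
      (a = 2 ∧ b = 1) ∨ (a = 3 ∧ b = 2) ∨ (a = 1 ∧ b = 3) := by
    revert a b; decide
  rcases hcases with ⟨rfl, rfl⟩ | ⟨rfl, rfl⟩ | ⟨rfl, rfl⟩ | ⟨rfl, rfl⟩ | ⟨rfl, rfl⟩ | ⟨rfl, rfl⟩
  · exact ⟨1, 3, by rw [h1, pow_one]⟩
  · exact ⟨1, 1, by rw [h2, pow_one]⟩
  · exact ⟨1, 2, by rw [h3, pow_one]⟩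
  · exact ⟨3, 3, by rw [hanti 2 1 rfl, h1, hI, neg_smul]⟩
  · exact ⟨3, 1, by rw [hanti 3 2 rfl, h2, hI, neg_smul]⟩
  · exact ⟨3, 2, by rw [hanti 1 3 rfl, h3, hI, neg_smul]⟩

theorem pauli_mul_self (a : Fin 4) : pauli a * pauli a = 1 := by
  ext i j
  fin_cases a <;> fin_cases i <;> fin_cases j <;>
    simp [pauli, Matrix.mul_apply, Fin.sum_univ_two]

theorem star_pauli (a : Fin 4) : star (pauli a) = pauli a := by
  ext i j
  fin_cases a <;> fin_cases i <;> fin_cases j <;> simp [pauli]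

theorem pauliPair_mul_self (α : Fin 4 × Fin 4) : pauliPair α * pauliPair α = 1 := by
  simp only [pauliPair]
  rw [← Matrix.mul_kronecker_mul, pauli_mul_self, pauli_mul_self, Matrix.one_kronecker_one]

theorem star_pauliPair (α : Fin 4 × Fin 4) : star (pauliPair α) = pauliPair α := by
  simp only [pauliPair]
  rw [Matrix.star_eq_conjTranspose, Matrix.conjTranspose_kronecker,
    ← Matrix.star_eq_conjTranspose, ← Matrix.star_eq_conjTranspose, star_pauli, star_pauli]

theorem pauliPair_mul_comm (α β : Fin 4 × Fin 4) :
    pauliPair α * pauliPair β =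
      (if antiPair α β then (-1 : ℂ) else 1) • (pauliPair β * pauliPair α) := by
  simp only [pauliPair]
  rw [← Matrix.mul_kronecker_mul, ← Matrix.mul_kronecker_mul, pauli_mul_comm α.1 β.1,
    pauli_mul_comm α.2 β.2, Matrix.smul_kronecker, Matrix.kronecker_smul, smul_smul]
  congr 1
  unfold antiPair
  cases anti α.1 β.1 <;> cases anti α.2 β.2 <;> simp

theorem exists_pauliPair_mul (α β : Fin 4 × Fin 4) :
    ∃ (k : ℕ) (γ : Fin 4 × Fin 4), pauliPair α * pauliPair β = Complex.I ^ k • pauliPair γ := by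
  obtain ⟨k, c, h⟩ := exists_pauli_mul α.1 β.1
  obtain ⟨k', c', h'⟩ := exists_pauli_mul α.2 β.2
  refine ⟨k + k', (c, c'), ?_⟩
  simp only [pauliPair]
  rw [← Matrix.mul_kronecker_mul, h, h', Matrix.smul_kronecker, Matrix.kronecker_smul, smul_smul,
    pow_add]

theorem eq_or_eq_neg_of_star_eq {M : Matrix (Fin 2 × Fin 2) (Fin 2 × Fin 2) ℂ} {k : ℕ}
    {γ : Fin 4 × Fin 4} (h : M = Complex.I ^ k • pauliPair γ) (hM : star M = M) :
    M = pauliPair γ ∨ M = -pauliPair γ := by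
  have h1 : star (Complex.I ^ k) = Complex.I ^ k := by
    rw [h, star_smul, star_pauliPair] at hM
    have h2 := congrArg (fun A => (A * pauliPair γ) (0, 0) (0, 0)) hM
    simpa [pauliPair_mul_self] using h2
  have h3 : (Complex.I ^ k) * (Complex.I ^ k) = 1 := by
    nth_rewrite 1 [← h1]
    rw [Complex.star_def, map_pow, Complex.conj_I, ← mul_pow]
    simp
  rcases mul_self_eq_one_iff.mp h3 with h4 | h4
  · exact Or.inl (by rw [h, h4, one_smul])
  · exact Or.inr (by rw [h, h4, neg_smul, one_smul])

/-- The Hermitian unitary that exchanges two anticommuting Pauli matrices. -/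
def swapMat (α β : Fin 4 × Fin 4) : Matrix (Fin 2 × Fin 2) (Fin 2 × Fin 2) ℂ :=
  ((Real.sqrt 2 : ℂ)⁻¹) • (pauliPair α + pauliPair β)

theorem star_swapMat (α β : Fin 4 × Fin 4) : star (swapMat α β) = swapMat α β := by
  rw [swapMat, star_smul, star_add, star_pauliPair, star_pauliPair, Complex.star_def, map_inv₀,
    Complex.conj_ofReal]

theorem swapMat_mul_mul (α β : Fin 4 × Fin 4) (X : Matrix (Fin 2 × Fin 2) (Fin 2 × Fin 2) ℂ) :
    swapMat α β * X * swapMat α β = (2⁻¹ : ℂ) •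
      ((pauliPair α + pauliPair β) * X * (pauliPair α + pauliPair β)) := by
  have : ((Real.sqrt 2 : ℂ)⁻¹) * ((Real.sqrt 2 : ℂ)⁻¹) = 2⁻¹ := by
    rw [← mul_inv, ← Complex.ofReal_mul, Real.mul_self_sqrt (by norm_num)]
    simp
  rw [swapMat, Matrix.smul_mul, Matrix.smul_mul, Matrix.mul_smul, smul_smul, this]

theorem swapMat_conj_of_comm {α β : Fin 4 × Fin 4} (h : antiPair α β = true)
    (X : Matrix (Fin 2 × Fin 2) (Fin 2 × Fin 2) ℂ) (e₁ e₂ : ℂ)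
    (h₁ : X * pauliPair α = e₁ • (pauliPair α * X)) (h₂ : X * pauliPair β = e₂ • (pauliPair β * X)) :
    swapMat α β * X * swapMat α β =
      (2⁻¹ * (e₁ + e₂)) • X + (2⁻¹ * (e₂ - e₁)) • (pauliPair α * pauliPair β * X) := by
  have hba : pauliPair β * pauliPair α = -(pauliPair α * pauliPair β) := by
    rw [pauliPair_mul_comm α β, h]; simp
  have e : (pauliPair α + pauliPair β) * X * (pauliPair α + pauliPair β) =
      (e₁ + e₂) • X + (e₂ - e₁) • (pauliPair α * pauliPair β * X) := by
    rw [mul_assoc, mul_add X, h₁, h₂, add_mul, mul_add, mul_add]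
    simp only [Matrix.mul_smul, ← mul_assoc, pauliPair_mul_self, hba, one_mul, neg_mul]
    module
  rw [swapMat_mul_mul, e, smul_add, smul_smul, smul_smul]

theorem swapMat_mul_self {α β : Fin 4 × Fin 4} (h : antiPair α β = true) :
    swapMat α β * swapMat α β = 1 := by
  have := swapMat_conj_of_comm h 1 1 1 (by simp) (by simp)
  rw [mul_one] at this
  rw [this]
  norm_num

theorem swapMat_conj {α β : Fin 4 × Fin 4} (h : antiPair α β = true) :
    swapMat α β * pauliPair α * swapMat α β = pauliPair β := by
  have hba : pauliPair β * pauliPair α = -(pauliPair α * pauliPair β) := by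
    rw [pauliPair_mul_comm α β, h]; simp
  rw [swapMat_conj_of_comm h (pauliPair α) 1 (-1) (by simp) (by rw [hba]; simp), mul_assoc, hba,
    mul_neg, ← mul_assoc, pauliPair_mul_self]
  norm_num

/-- The swap of two anticommuting Pauli matrices as a unitary. -/
def swapU {α β : Fin 4 × Fin 4} (h : antiPair α β = true) : U4 :=
  ⟨swapMat α β, by
    rw [Matrix.mem_unitaryGroup_iff, star_swapMat, swapMat_mul_self h]⟩

theorem mapsPaulis_swapU {α β : Fin 4 × Fin 4} (h : antiPair α β = true) :
    MapsPaulis (swapU h) := by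
  intro a b
  set γ : Fin 4 × Fin 4 := (a, b)
  have hM : ∀ M : Matrix (Fin 2 × Fin 2) (Fin 2 × Fin 2) ℂ,
      (∃ δ, M = pauliPair δ ∨ M = -pauliPair δ) → ∃ c d : Fin 4,
        M = pauli c ⊗ₖ pauli d ∨ M = -(pauli c ⊗ₖ pauli d) := fun M ⟨δ, hδ⟩ => ⟨δ.1, δ.2, hδ⟩
  apply hM
  change ∃ δ, swapMat α β * pauliPair γ * star (swapMat α β) = pauliPair δ ∨
    swapMat α β * pauliPair γ * star (swapMat α β) = -pauliPair δ
  have hconj := swapMat_conj_of_comm h (pauliPair γ) _ _ (pauliPair_mul_comm γ α)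
    (pauliPair_mul_comm γ β)
  have hstar : star (swapMat α β * pauliPair γ * swapMat α β) =
      swapMat α β * pauliPair γ * swapMat α β := by
    rw [star_mul, star_mul, star_swapMat, star_pauliPair, mul_assoc]
  rw [star_swapMat]
  obtain ⟨k, δ, hk⟩ := exists_pauliPair_mul α β
  obtain ⟨k', δ', hk'⟩ := exists_pauliPair_mul δ γ
  have hprod : pauliPair α * pauliPair β * pauliPair γ = Complex.I ^ (k + k') • pauliPair δ' := by
    rw [hk, Matrix.smul_mul, hk', smul_smul, pow_add]
  have hI2 : Complex.I ^ 2 = -1 := Complex.I_sq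
  rcases Bool.eq_false_or_eq_true (antiPair γ α) with h1 | h1 <;>
    rcases Bool.eq_false_or_eq_true (antiPair γ β) with h2 | h2 <;> rw [h1, h2] at hconj <;>
    norm_num at hconj
  · exact ⟨γ, Or.inr hconj⟩
  · refine ⟨δ', eq_or_eq_neg_of_star_eq (k := k + k') ?_ hstar⟩
    rw [hconj, hprod]
  · refine ⟨δ', eq_or_eq_neg_of_star_eq (k := k + k' + 2) ?_ hstar⟩
    rw [hconj, hprod, pow_add _ (k + k'), hI2]
    simp
  · exact ⟨γ, Or.inl hconj⟩

theorem swapU_mem_gateGroup (G : GateSet) {α β : Fin 4 × Fin 4} (h : antiPair α β = true) :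
    swapU h ∈ gateGroup G := by
  cases G
  · exact Subgroup.mem_top _
  · have hinv : (swapU h)⁻¹ = swapU h := by
      apply inv_eq_of_mul_eq_one_left
      exact Subtype.ext (swapMat_mul_self h)
    exact ⟨mapsPaulis_swapU h, by rw [hinv]; exact mapsPaulis_swapU h⟩

/-- The squared modulus of a Pauli coefficient of the state `X` after a gate. -/
def gateCoeff (X : Matrix (Fin 2 × Fin 2) (Fin 2 × Fin 2) ℂ) (α : Fin 4 × Fin 4) (U : U4) : ℝ :=
  ‖(pauliPair α * ((U : Matrix (Fin 2 × Fin 2) (Fin 2 × Fin 2) ℂ) * X *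
    star (U : Matrix (Fin 2 × Fin 2) (Fin 2 × Fin 2) ℂ))).trace‖ ^ 2

theorem gateCoeff_one (X : Matrix (Fin 2 × Fin 2) (Fin 2 × Fin 2) ℂ) (α : Fin 4 × Fin 4) :
    gateCoeff X α 1 = ‖(pauliPair α * X).trace‖ ^ 2 := by
  simp [gateCoeff]

theorem continuous_gateCoeff (X : Matrix (Fin 2 × Fin 2) (Fin 2 × Fin 2) ℂ) (α : Fin 4 × Fin 4) :
    Continuous (gateCoeff X α) := by
  unfold gateCoeff
  have h : Continuous fun U : U4 => (U : Matrix (Fin 2 × Fin 2) (Fin 2 × Fin 2) ℂ) * X *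
      star (U : Matrix (Fin 2 × Fin 2) (Fin 2 × Fin 2) ℂ) :=
    (continuous_subtype_val.mul continuous_const).mul continuous_subtype_val.star
  exact ((continuous_const.mul h).matrix_trace.norm).pow 2

theorem gateCoeff_swapU_mul (X : Matrix (Fin 2 × Fin 2) (Fin 2 × Fin 2) ℂ) {α β : Fin 4 × Fin 4}
    (h : antiPair α β = true) (U : U4) :
    gateCoeff X α (swapU h * U) = gateCoeff X β U := by
  have e : pauliPair α * ((swapMat α β * (U : Matrix (Fin 2 × Fin 2) (Fin 2 × Fin 2) ℂ)) * X *
      star (swapMat α β * (U : Matrix (Fin 2 × Fin 2) (Fin 2 × Fin 2) ℂ))) =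
      pauliPair α * swapMat α β * ((U : Matrix (Fin 2 × Fin 2) (Fin 2 × Fin 2) ℂ) * X *
      star (U : Matrix (Fin 2 × Fin 2) (Fin 2 × Fin 2) ℂ)) * swapMat α β := by
    rw [star_mul, star_swapMat]
    simp only [mul_assoc]
  change ‖(pauliPair α * ((swapMat α β * (U : Matrix (Fin 2 × Fin 2) (Fin 2 × Fin 2) ℂ)) * X *
      star (swapMat α β * (U : Matrix (Fin 2 × Fin 2) (Fin 2 × Fin 2) ℂ)))).trace‖ ^ 2 = _
  rw [e, Matrix.trace_mul_comm, ← mul_assoc, ← mul_assoc (swapMat α β) (pauliPair α),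
    swapMat_conj h]
  rfl

theorem integral_gateCoeff_eq_of_anti (G : GateSet)
    (X : Matrix (Fin 2 × Fin 2) (Fin 2 × Fin 2) ℂ) {α β : Fin 4 × Fin 4}
    (h : antiPair α β = true) :
    ∫ U : gateGroup G, gateCoeff X α U ∂(gateMeasure G) =
      ∫ U : gateGroup G, gateCoeff X β U ∂(gateMeasure G) := by
  have hinv : (gateMeasure G).IsMulLeftInvariant := by unfold gateMeasure; infer_instance
  rw [← integral_mul_left_eq_self _ (⟨swapU h, swapU_mem_gateGroup G h⟩ : gateGroup G)]
  simp only [Subgroup.coe_mul]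
  simp only [gateCoeff_swapU_mul]

theorem integral_gateCoeff_eq (G : GateSet) (X : Matrix (Fin 2 × Fin 2) (Fin 2 × Fin 2) ℂ)
    {α β : Fin 4 × Fin 4} (hα : α ≠ 0) (hβ : β ≠ 0) :
    ∫ U : gateGroup G, gateCoeff X α U ∂(gateMeasure G) =
      ∫ U : gateGroup G, gateCoeff X β U ∂(gateMeasure G) := by
  have hex : ∀ α β : Fin 4 × Fin 4, α ≠ 0 → β ≠ 0 →
      ∃ γ, antiPair α γ = true ∧ antiPair γ β = true := by decide +kernel
  obtain ⟨γ, h1, h2⟩ := hex α β hα hβ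
  rw [integral_gateCoeff_eq_of_anti G X h1, integral_gateCoeff_eq_of_anti G X h2]

theorem sum_pauliPair_mul_star (x y x' y' : Fin 2 × Fin 2) :
    ∑ α, pauliPair α x y * star (pauliPair α x' y') =
      if x = x' ∧ y = y' then ((4 : ℝ) : ℂ) else 0 := by
  have : ∀ α : Fin 4 × Fin 4, pauliPair α x y * star (pauliPair α x' y') =
      (pauli α.1 x.1 y.1 * star (pauli α.1 x'.1 y'.1)) *
      (pauli α.2 x.2 y.2 * star (pauli α.2 x'.2 y'.2)) := by
    intro α
    simp only [pauliPair, Matrix.kroneckerMap_apply, star_mul']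
    ring
  simp only [this]
  rw [Fintype.sum_prod_type]
  simp only [← Finset.mul_sum, ← Finset.sum_mul, sum_pauli_mul_star, Prod.ext_iff]
  split_ifs <;> first | tauto | norm_num

theorem pauliPair_zero : pauliPair 0 = 1 := by
  simp [pauliPair, pauli_zero]

theorem sum_gateCoeff (X : Matrix (Fin 2 × Fin 2) (Fin 2 × Fin 2) ℂ) (U : U4) :
    ∑ α, gateCoeff X α U = ∑ α, gateCoeff X α 1 := by
  have hHS : ∀ M : Matrix (Fin 2 × Fin 2) (Fin 2 × Fin 2) ℂ,
      ((∑ x, ∑ y, ‖M x y‖ ^ 2 : ℝ) : ℂ) = (M * star M).trace := by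
    intro M
    simp only [Matrix.trace, Matrix.diag, Matrix.mul_apply, Matrix.star_apply]
    push_cast
    refine Finset.sum_congr rfl fun x _ => Finset.sum_congr rfl fun y _ => ?_
    rw [Complex.star_def, Complex.mul_conj, Complex.normSq_eq_norm_sq]
    push_cast; rfl
  unfold gateCoeff
  rw [sum_norm_trace_mul_sq sum_pauliPair_mul_star, sum_norm_trace_mul_sq sum_pauliPair_mul_star]
  congr 1
  apply Complex.ofReal_injective
  rw [hHS, hHS]
  have hU : star (U : Matrix (Fin 2 × Fin 2) (Fin 2 × Fin 2) ℂ) * U = 1 :=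
    Matrix.mem_unitaryGroup_iff'.mp U.2
  rw [OneMemClass.coe_one]
  generalize (U : Matrix (Fin 2 × Fin 2) (Fin 2 × Fin 2) ℂ) = V at hU ⊢
  have e : V * X * star V * star (V * X * star V) = V * (X * star X * star V) := by
    calc _ = V * X * (star V * V) * star X * star V := by
            simp only [star_mul, star_star, mul_assoc]
      _ = _ := by rw [hU]; simp only [mul_one, mul_assoc]
  rw [e, Matrix.trace_mul_comm, mul_assoc, hU]
  simp

theorem gateCoeff_zero (X : Matrix (Fin 2 × Fin 2) (Fin 2 × Fin 2) ℂ) (U : U4) :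
    gateCoeff X 0 U = gateCoeff X 0 1 := by
  have hU : star (U : Matrix (Fin 2 × Fin 2) (Fin 2 × Fin 2) ℂ) * U = 1 :=
    Matrix.mem_unitaryGroup_iff'.mp U.2
  unfold gateCoeff
  rw [pauliPair_zero, one_mul, one_mul, Matrix.trace_mul_comm, ← mul_assoc, hU]
  simp

theorem integrable_gateCoeff (G : GateSet) (X : Matrix (Fin 2 × Fin 2) (Fin 2 × Fin 2) ℂ)
    (α : Fin 4 × Fin 4) : Integrable (fun U : gateGroup G => gateCoeff X α U) (gateMeasure G) :=
  ((continuous_gateCoeff X α).comp continuous_subtype_val).integrable_of_hasCompactSupport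
    (HasCompactSupport.of_compactSpace _)

/-- The second moment of a random gate: every nontrivial Pauli coefficient is mapped to the
uniform distribution on the nontrivial ones. -/
theorem integral_gateCoeff (G : GateSet) (X : Matrix (Fin 2 × Fin 2) (Fin 2 × Fin 2) ℂ)
    {α : Fin 4 × Fin 4} (hα : α ≠ 0) :
    ∫ U : gateGroup G, gateCoeff X α U ∂(gateMeasure G) =
      (1 / 15) * ∑ β ∈ Finset.univ.erase 0, gateCoeff X β 1 := by
  have h1 : ∑ β ∈ Finset.univ.erase (0 : Fin 4 × Fin 4),
      ∫ U : gateGroup G, gateCoeff X β U ∂(gateMeasure G) =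
      ∑ β ∈ Finset.univ.erase 0, gateCoeff X β 1 := by
    rw [← integral_finsetSum _ fun β _ => integrable_gateCoeff G X β]
    have : ∀ U : gateGroup G, ∑ β ∈ Finset.univ.erase (0 : Fin 4 × Fin 4), gateCoeff X β U =
        ∑ β ∈ Finset.univ.erase 0, gateCoeff X β 1 := by
      intro U
      have h2 := sum_gateCoeff X (U : U4)
      rw [← Finset.add_sum_erase _ _ (Finset.mem_univ 0),
        ← Finset.add_sum_erase _ (fun α => gateCoeff X α 1) (Finset.mem_univ 0),
        gateCoeff_zero] at h2
      linarith
    simp [this]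
  rw [← h1, Finset.sum_congr rfl fun β hβ =>
    integral_gateCoeff_eq G X (Finset.ne_of_mem_erase hβ) hα, Finset.sum_const]
  simp

/-! ### The action of a gate -/

/-- The qubits outside the pair `p`. -/
abbrev Rest {n : ℕ} (p : Pair n) : Type := {k : Fin n // k ≠ p.1.1 ∧ k ≠ p.1.2}

/-- A function on the qubits, split into its values on the pair `p` and on the other qubits. -/
def splitEquiv {n : ℕ} (p : Pair n) (κ : Type) : (Fin n → κ) ≃ (κ × κ) × (Rest p → κ) where
  toFun x := ((x p.1.1, x p.1.2), fun k => x k)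
  invFun q k := if h1 : k = p.1.1 then q.1.1 else if h2 : k = p.1.2 then q.1.2 else q.2 ⟨k, h1, h2⟩
  left_inv x := by
    funext k
    dsimp only
    split_ifs with h1 h2
    · rw [h1]
    · rw [h2]
    · rfl
  right_inv q := by
    have h : p.1.2 ≠ p.1.1 := p.2.ne'
    ext k
    · simp
    · simp [h]
    · simp [k.2.1, k.2.2]

theorem splitEquiv_symm_fst {n : ℕ} (p : Pair n) (κ : Type) (q : (κ × κ) × (Rest p → κ)) :
    (splitEquiv p κ).symm q p.1.1 = q.1.1 := by
  simp [splitEquiv]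

theorem splitEquiv_symm_snd {n : ℕ} (p : Pair n) (κ : Type) (q : (κ × κ) × (Rest p → κ)) :
    (splitEquiv p κ).symm q p.1.2 = q.1.2 := by
  have h : p.1.2 ≠ p.1.1 := p.2.ne'
  simp [splitEquiv, h]

theorem splitEquiv_symm_rest {n : ℕ} (p : Pair n) (κ : Type) (q : (κ × κ) × (Rest p → κ))
    (k : Rest p) : (splitEquiv p κ).symm q k = q.2 k := by
  simp [splitEquiv, k.2.1, k.2.2]

@[to_additive]
theorem prod_split {n : ℕ} (p : Pair n) {M : Type*} [CommMonoid M] (f : Fin n → M) :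
    ∏ k, f k = f p.1.1 * f p.1.2 * ∏ k : Rest p, f k := by
  have h : p.1.2 ≠ p.1.1 := p.2.ne'
  rw [← Fintype.prod_subtype_mul_prod_subtype (fun k => ¬ (k ≠ p.1.1 ∧ k ≠ p.1.2)), mul_comm,
    mul_comm (f p.1.1 * f p.1.2)]
  congr 1
  · exact Fintype.prod_equiv (Equiv.subtypeEquivRight fun k => by simp) _ _ fun _ => rfl
  · rw [← Finset.prod_pair h.symm]
    exact (Finset.prod_subtype _ (by simp; tauto) f).symm

/-- An operator with its qubits split into the pair `p` and the other qubits. -/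
def splitOp {n : ℕ} (p : Pair n) (A : Op (Fin n)) :
    Matrix ((Fin 2 × Fin 2) × (Rest p → Fin 2)) ((Fin 2 × Fin 2) × (Rest p → Fin 2)) ℂ :=
  A.submatrix (splitEquiv p (Fin 2)).symm (splitEquiv p (Fin 2)).symm

theorem splitOp_mul {n : ℕ} (p : Pair n) (A B : Op (Fin n)) :
    splitOp p (A * B) = splitOp p A * splitOp p B :=
  (Matrix.submatrix_mul_equiv A B _ _ _).symm

theorem splitOp_injective {n : ℕ} (p : Pair n) : Function.Injective (splitOp p) := by
  intro A B h
  ext x y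
  have := congrFun (congrFun h (splitEquiv p _ x)) (splitEquiv p _ y)
  simpa [splitOp] using this

theorem trace_splitOp {n : ℕ} (p : Pair n) (A : Op (Fin n)) : (splitOp p A).trace = A.trace := by
  simp only [Matrix.trace, Matrix.diag, splitOp, Matrix.submatrix_apply]
  exact Equiv.sum_comp (splitEquiv p (Fin 2)).symm fun x => A x x

theorem splitOp_conjTranspose {n : ℕ} (p : Pair n) (A : Op (Fin n)) :
    splitOp p A.conjTranspose = (splitOp p A).conjTranspose := rfl

theorem splitOp_mat {G : GateSet} {n : ℕ} (g : Gate G n) :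
    splitOp g.1 (Gate.mat g) =
      ((g.2 : U4) : Matrix (Fin 2 × Fin 2) (Fin 2 × Fin 2) ℂ) ⊗ₖ (1 : Op (Rest g.1)) := by
  ext ⟨a, r⟩ ⟨b, s⟩
  simp only [splitOp, Matrix.submatrix_apply, Gate.mat, splitEquiv_symm_fst, splitEquiv_symm_snd,
    Matrix.kroneckerMap_apply, Matrix.one_apply, mul_ite, mul_one, mul_zero]
  have hiff : (∀ k, k ∉ Gate.qubits g → (splitEquiv g.1 (Fin 2)).symm (a, r) k =
      (splitEquiv g.1 (Fin 2)).symm (b, s) k) ↔ r = s := by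
    constructor
    · intro h
      funext k
      have := h k (by simp [Gate.qubits, k.2.1, k.2.2])
      rwa [splitEquiv_symm_rest, splitEquiv_symm_rest] at this
    · rintro rfl k hk
      have hk' : k ≠ g.1.1.1 ∧ k ≠ g.1.1.2 := by simpa [Gate.qubits] using hk
      exact (splitEquiv_symm_rest g.1 _ (a, r) ⟨k, hk'⟩).trans
        (splitEquiv_symm_rest g.1 _ (b, r) ⟨k, hk'⟩).symm
  simp only [hiff]

theorem conjTranspose_mat_mul_mat {G : GateSet} {n : ℕ} (g : Gate G n) :
    (Gate.mat g).conjTranspose * Gate.mat g = 1 := by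
  have hU : ((g.2 : U4) : Matrix (Fin 2 × Fin 2) (Fin 2 × Fin 2) ℂ).conjTranspose * (g.2 : U4) = 1 :=
    Matrix.mem_unitaryGroup_iff'.mp (g.2 : U4).2
  apply splitOp_injective g.1
  rw [splitOp_mul, splitOp_conjTranspose, splitOp_mat, Matrix.conjTranspose_kronecker,
    ← Matrix.mul_kronecker_mul, hU, Matrix.conjTranspose_one, one_mul, Matrix.one_kronecker_one]
  ext x y
  simp [splitOp, Matrix.one_apply]

theorem exists_splitOp_mat_of_disjoint {G : GateSet} {n : ℕ} {g h : Gate G n}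
    (hd : Disjoint (Gate.qubits g) (Gate.qubits h)) :
    ∃ B : Op (Rest g.1), splitOp g.1 (Gate.mat h) =
      (1 : Matrix (Fin 2 × Fin 2) (Fin 2 × Fin 2) ℂ) ⊗ₖ B := by
  have hmem : ∀ k ∈ Gate.qubits h, k ≠ g.1.1.1 ∧ k ≠ g.1.1.2 := by
    intro k hk
    have := Finset.disjoint_right.mp hd hk
    simpa [Gate.qubits] using this
  have h1 := hmem h.1.1.1 (by simp [Gate.qubits])
  have h2 := hmem h.1.1.2 (by simp [Gate.qubits])
  have hg1 : g.1.1.1 ∉ Gate.qubits h := Finset.disjoint_left.mp hd (by simp [Gate.qubits])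
  have hg2 : g.1.1.2 ∉ Gate.qubits h := Finset.disjoint_left.mp hd (by simp [Gate.qubits])
  obtain ⟨B, hB⟩ : ∃ B : Op (Rest g.1), ∀ r s, B r s =
      if ∀ k : Rest g.1, (k : Fin n) ∉ Gate.qubits h → r k = s k then
        ((h.2 : U4) : Matrix (Fin 2 × Fin 2) (Fin 2 × Fin 2) ℂ) (r ⟨_, h1⟩, r ⟨_, h2⟩)
          (s ⟨_, h1⟩, s ⟨_, h2⟩) else 0 := ⟨_, fun _ _ => rfl⟩
  refine ⟨B, ?_⟩
  ext ⟨a, r⟩ ⟨b, s⟩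
  have e1 : ∀ q, (splitEquiv g.1 (Fin 2)).symm q h.1.1.1 = q.2 ⟨_, h1⟩ :=
    fun q => splitEquiv_symm_rest g.1 _ q ⟨_, h1⟩
  have e2 : ∀ q, (splitEquiv g.1 (Fin 2)).symm q h.1.1.2 = q.2 ⟨_, h2⟩ :=
    fun q => splitEquiv_symm_rest g.1 _ q ⟨_, h2⟩
  simp only [splitOp, Matrix.submatrix_apply, Gate.mat, Matrix.kroneckerMap_apply,
    Matrix.one_apply, ite_mul, one_mul, zero_mul, e1, e2, hB]
  have hiff : (∀ k, k ∉ Gate.qubits h → (splitEquiv g.1 (Fin 2)).symm (a, r) k =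
      (splitEquiv g.1 (Fin 2)).symm (b, s) k) ↔
      a = b ∧ ∀ k : Rest g.1, (k : Fin n) ∉ Gate.qubits h → r k = s k := by
    constructor
    · intro hh
      refine ⟨Prod.ext ?_ ?_, fun k hk => ?_⟩
      · have := hh _ hg1
        rwa [splitEquiv_symm_fst, splitEquiv_symm_fst] at this
      · have := hh _ hg2
        rwa [splitEquiv_symm_snd, splitEquiv_symm_snd] at this
      · have := hh _ hk
        rwa [splitEquiv_symm_rest, splitEquiv_symm_rest] at this
    · rintro ⟨rfl, hrs⟩ k hk
      by_cases k1 : k = g.1.1.1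
      · rw [k1, splitEquiv_symm_fst, splitEquiv_symm_fst]
      by_cases k2 : k = g.1.1.2
      · rw [k2, splitEquiv_symm_snd, splitEquiv_symm_snd]
      exact (splitEquiv_symm_rest g.1 _ (a, r) ⟨k, k1, k2⟩).trans ((hrs ⟨k, k1, k2⟩ hk).trans
        (splitEquiv_symm_rest g.1 _ (a, s) ⟨k, k1, k2⟩).symm)
  simp only [hiff]
  split_ifs <;> first | rfl | tauto

theorem mat_mul_mat_comm {G : GateSet} {n : ℕ} {g h : Gate G n}
    (hd : Disjoint (Gate.qubits g) (Gate.qubits h)) :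
    Gate.mat g * Gate.mat h = Gate.mat h * Gate.mat g := by
  obtain ⟨B, hB⟩ := exists_splitOp_mat_of_disjoint hd
  apply splitOp_injective g.1
  rw [splitOp_mul, splitOp_mul, splitOp_mat, hB, ← Matrix.mul_kronecker_mul,
    ← Matrix.mul_kronecker_mul]
  simp

/-! ### The output of the parallelized circuit -/

/-- The state after a gate. -/
def applyGate {G : GateSet} {n : ℕ} (ρ : Op (Fin n)) (g : Gate G n) : Op (Fin n) :=
  Gate.mat g * ρ * (Gate.mat g).conjTranspose

theorem trace_applyGate {G : GateSet} {n : ℕ} (ρ : Op (Fin n)) (g : Gate G n) :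
    (applyGate ρ g).trace = ρ.trace := by
  rw [applyGate, Matrix.trace_mul_comm, ← mul_assoc, conjTranspose_mat_mul_mat, one_mul]

theorem trace_foldl_applyGate {G : GateSet} {n : ℕ} (gs : List (Gate G n)) (ρ : Op (Fin n)) :
    (gs.foldl applyGate ρ).trace = ρ.trace := by
  induction gs generalizing ρ with
  | nil => rfl
  | cons g gs ih => rw [List.foldl_cons, ih, trace_applyGate]

theorem applyGate_comm {G : GateSet} {n : ℕ} {g h : Gate G n}
    (hd : Disjoint (Gate.qubits g) (Gate.qubits h)) (ρ : Op (Fin n)) :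
    applyGate (applyGate ρ g) h = applyGate (applyGate ρ h) g := by
  have e : ∀ A B : Op (Fin n), A * (B * ρ * B.conjTranspose) * A.conjTranspose =
      (A * B) * ρ * (A * B).conjTranspose := by
    intro A B
    rw [Matrix.conjTranspose_mul]
    simp only [mul_assoc]
  simp only [applyGate]
  rw [e, e, mat_mul_mat_comm hd]

theorem foldl_applyGate_comm {G : GateSet} {n : ℕ} {g : Gate G n} (gs : List (Gate G n))
    (hd : ∀ h ∈ gs, Disjoint (Gate.qubits g) (Gate.qubits h)) (ρ : Op (Fin n)) :
    gs.foldl applyGate (applyGate ρ g) = applyGate (gs.foldl applyGate ρ) g := by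
  induction gs generalizing ρ with
  | nil => rfl
  | cons h gs ih =>
    rw [List.foldl_cons, List.foldl_cons, applyGate_comm (hd h (by simp)),
      ih fun h' hh' => hd h' (by simp [hh'])]

theorem foldl_flatten_addGate {G : GateSet} {n : ℕ} (g : Gate G n) (Ls : List (List (Gate G n)))
    (ρ : Op (Fin n)) :
    (addGate g Ls).flatten.foldl applyGate ρ = applyGate (Ls.flatten.foldl applyGate ρ) g := by
  induction Ls generalizing ρ with
  | nil => simp [addGate]
  | cons L Ls ih =>
    unfold addGate
    split_ifs with hd
    · rw [List.flatten_cons, List.flatten_cons, List.foldl_append, List.foldl_append,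
        List.foldl_append, List.foldl_cons, List.foldl_nil, foldl_applyGate_comm]
      intro h hh
      exact hd h (by rw [List.flatten_cons, List.mem_append]; exact Or.inr hh)
    · rw [List.flatten_cons, List.flatten_cons, List.foldl_append, List.foldl_append, ih]

theorem output_eq_foldl {G : GateSet} {n t : ℕ} (ω : Fin t → Gate G n) (ρ : Op (Fin n)) :
    output ω ρ = (List.ofFn ω).foldl applyGate ρ := by
  have h1 : ∀ (gs : List (Gate G n)) (Ls : List (List (Gate G n))),
      (gs.foldl (fun Ls g => addGate g Ls) Ls).flatten.foldl applyGate ρ =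
        gs.foldl applyGate (Ls.flatten.foldl applyGate ρ) := by
    intro gs
    induction gs with
    | nil => intro Ls; rfl
    | cons g gs ih => intro Ls; rw [List.foldl_cons, ih, foldl_flatten_addGate, List.foldl_cons]
  have h2 := h1 (List.ofFn ω) []
  rw [List.foldl_flatten] at h2
  exact h2

/-! ### Pauli coefficients after a gate -/

theorem splitOp_pauliString {n : ℕ} (p : Pair n) (q : (Fin 4 × Fin 4) × (Rest p → Fin 4)) :
    splitOp p (pauliString ((splitEquiv p (Fin 4)).symm q)) = pauliPair q.1 ⊗ₖ pauliString q.2 := by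
  ext ⟨a, r⟩ ⟨b, s⟩
  simp only [splitOp, Matrix.submatrix_apply, pauliString, Matrix.kroneckerMap_apply, pauliPair]
  rw [prod_split p]
  simp only [splitEquiv_symm_fst, splitEquiv_symm_snd, splitEquiv_symm_rest]

/-- The partial trace of `(1 ⊗ B) * M` over the second tensor factor. -/
def partialTrace {l m : Type} [Fintype m] (B : Matrix m m ℂ) (M : Matrix (l × m) (l × m) ℂ) :
    Matrix l l ℂ :=
  fun a b => ∑ r, ∑ s, B r s * M (a, s) (b, r)

theorem trace_kronecker_mul {l m : Type} [Fintype l] [Fintype m] (A : Matrix l l ℂ)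
    (B : Matrix m m ℂ) (M : Matrix (l × m) (l × m) ℂ) :
    ((A ⊗ₖ B) * M).trace = (A * partialTrace B M).trace := by
  simp only [Matrix.trace, Matrix.diag, Matrix.mul_apply, Fintype.sum_prod_type, partialTrace,
    Matrix.kroneckerMap_apply, Finset.mul_sum]
  refine Finset.sum_congr rfl fun a _ => ?_
  rw [Finset.sum_comm]
  refine Finset.sum_congr rfl fun b _ => Finset.sum_congr rfl fun r _ =>
    Finset.sum_congr rfl fun s _ => ?_
  ring

theorem coeffSq_applyGate {G : GateSet} {n : ℕ} (ρ : Op (Fin n)) (g : Gate G n)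
    (q : (Fin 4 × Fin 4) × (Rest g.1 → Fin 4)) :
    coeffSq ((splitEquiv g.1 (Fin 4)).symm q) (applyGate ρ g) =
      gateCoeff (partialTrace (pauliString q.2) (splitOp g.1 ρ)) q.1 g.2 := by
  unfold coeffSq gateCoeff
  congr 2
  rw [← trace_splitOp g.1, splitOp_mul, splitOp_pauliString, applyGate, splitOp_mul, splitOp_mul,
    splitOp_conjTranspose, splitOp_mat, Matrix.conjTranspose_kronecker, Matrix.conjTranspose_one,
    ← Matrix.star_eq_conjTranspose, ← mul_assoc, Matrix.trace_mul_comm, ← mul_assoc, ← mul_assoc,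
    ← Matrix.mul_kronecker_mul, ← Matrix.mul_kronecker_mul, trace_kronecker_mul, one_mul, mul_one,
    mul_assoc, mul_assoc, Matrix.trace_mul_comm]
  simp only [mul_assoc]

theorem coeffSq_split {n : ℕ} (p : Pair n) (ρ : Op (Fin n))
    (q : (Fin 4 × Fin 4) × (Rest p → Fin 4)) :
    coeffSq ((splitEquiv p (Fin 4)).symm q) ρ =
      gateCoeff (partialTrace (pauliString q.2) (splitOp p ρ)) q.1 1 := by
  rw [gateCoeff_one, coeffSq, ← trace_splitOp p, splitOp_mul, splitOp_pauliString,
    trace_kronecker_mul]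

/-! ### The expected Pauli weight distribution -/

/-- The expectation of a function of the weight under the Pauli distribution of a state. -/
def weightSum {n : ℕ} (h : ℕ → ℝ) (ρ : Op (Fin n)) : ℝ :=
  ∑ ν : Fin n → Fin 4, coeffSq ν ρ * h (supp ν).card

/-- The weight of a two-qubit Pauli matrix. -/
def pairWeight (α : Fin 4 × Fin 4) : ℕ := (if α.1 ≠ 0 then 1 else 0) + (if α.2 ≠ 0 then 1 else 0)

theorem card_supp_split {n : ℕ} (p : Pair n) (q : (Fin 4 × Fin 4) × (Rest p → Fin 4)) :
    (supp ((splitEquiv p (Fin 4)).symm q)).card = (supp q.2).card + pairWeight q.1 := by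
  unfold supp
  rw [Finset.card_filter, Finset.card_filter, sum_split p]
  simp only [splitEquiv_symm_fst, splitEquiv_symm_snd, splitEquiv_symm_rest, pairWeight]
  rw [add_comm]

theorem sum_pairWeight (h : ℕ → ℝ) (m : ℕ) :
    ∑ α ∈ Finset.univ.erase (0 : Fin 4 × Fin 4), h (m + pairWeight α) =
      6 * h (m + 1) + 9 * h (m + 2) := by
  have h1 := Finset.add_sum_erase Finset.univ (fun α : Fin 4 × Fin 4 => h (m + pairWeight α))
    (Finset.mem_univ 0)
  have h2 : ∑ α : Fin 4 × Fin 4, h (m + pairWeight α) = h m + (6 * h (m + 1) + 9 * h (m + 2)) := by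
    rw [Fintype.sum_prod_type]
    have n2 : (2 : Fin 4) ≠ 0 := by decide
    have n3 : (3 : Fin 4) ≠ 0 := by decide
    simp only [Fin.sum_univ_four, pairWeight]
    simp [n2, n3]
    ring
  have h3 : pairWeight 0 = 0 := by simp [pairWeight]
  rw [h2, h3, add_zero] at h1
  linarith

theorem weightSum_applyGate {G : GateSet} {n : ℕ} (h : ℕ → ℝ) (ρ : Op (Fin n)) (g : Gate G n) :
    weightSum h (applyGate ρ g) = ∑ τ : Rest g.1 → Fin 4, ∑ α : Fin 4 × Fin 4,
      gateCoeff (partialTrace (pauliString τ) (splitOp g.1 ρ)) α g.2 *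
        h ((supp τ).card + pairWeight α) := by
  rw [weightSum, ← Equiv.sum_comp (splitEquiv g.1 (Fin 4)).symm, Fintype.sum_prod_type_right]
  simp only [coeffSq_applyGate, card_supp_split]

/-- The effect of a random gate on the pair `p` on a function of the weight. -/
def pairStep {n : ℕ} (h : ℕ → ℝ) (p : Pair n) (ν : Fin n → Fin 4) : ℝ :=
  if ν p.1.1 = 0 ∧ ν p.1.2 = 0 then h (supp ν).card
  else if ν p.1.1 ≠ 0 ∧ ν p.1.2 ≠ 0 then
    2 / 5 * h ((supp ν).card - 1) + 3 / 5 * h (supp ν).card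
  else 2 / 5 * h (supp ν).card + 3 / 5 * h ((supp ν).card + 1)

theorem pairStep_split {n : ℕ} (h : ℕ → ℝ) (p : Pair n)
    (q : (Fin 4 × Fin 4) × (Rest p → Fin 4)) :
    pairStep h p ((splitEquiv p (Fin 4)).symm q) = if q.1 = 0 then h (supp q.2).card else
      2 / 5 * h ((supp q.2).card + 1) + 3 / 5 * h ((supp q.2).card + 2) := by
  unfold pairStep
  rw [splitEquiv_symm_fst, splitEquiv_symm_snd, card_supp_split]
  obtain ⟨⟨a, b⟩, τ⟩ := q
  by_cases ha : a = 0 <;> by_cases hb : b = 0 <;> simp [pairWeight, ha, hb]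

theorem integral_sum_gateCoeff (G : GateSet) (X : Matrix (Fin 2 × Fin 2) (Fin 2 × Fin 2) ℂ)
    (h : ℕ → ℝ) (m : ℕ) :
    ∫ U : gateGroup G, ∑ α, gateCoeff X α U * h (m + pairWeight α) ∂(gateMeasure G) =
      ∑ β, gateCoeff X β 1 *
        if β = 0 then h m else 2 / 5 * h (m + 1) + 3 / 5 * h (m + 2) := by
  rw [integral_finsetSum _ fun α _ => (integrable_gateCoeff G X α).mul_const _]
  simp only [integral_mul_const]
  rw [← Finset.add_sum_erase _ _ (Finset.mem_univ (0 : Fin 4 × Fin 4)),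
    ← Finset.add_sum_erase Finset.univ (fun β => gateCoeff X β 1 * _)
      (Finset.mem_univ (0 : Fin 4 × Fin 4))]
  congr 1
  · simp only [gateCoeff_zero]
    simp [pairWeight]
  · have e1 : ∀ α ∈ Finset.univ.erase (0 : Fin 4 × Fin 4),
        (∫ U : gateGroup G, gateCoeff X α U ∂(gateMeasure G)) * h (m + pairWeight α) =
        ((1 / 15) * ∑ β ∈ Finset.univ.erase 0, gateCoeff X β 1) * h (m + pairWeight α) :=
      fun α hα => by rw [integral_gateCoeff G X (Finset.ne_of_mem_erase hα)]
    have e2 : ∀ β ∈ Finset.univ.erase (0 : Fin 4 × Fin 4), gateCoeff X β 1 *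
        (if β = 0 then h m else 2 / 5 * h (m + 1) + 3 / 5 * h (m + 2)) =
        gateCoeff X β 1 * (2 / 5 * h (m + 1) + 3 / 5 * h (m + 2)) :=
      fun β hβ => by rw [if_neg (Finset.ne_of_mem_erase hβ)]
    rw [Finset.sum_congr rfl e1, Finset.sum_congr rfl e2, ← Finset.mul_sum, sum_pairWeight,
      ← Finset.sum_mul]
    ring

theorem weightSum_applyGate_pair {G : GateSet} {n : ℕ} (h : ℕ → ℝ) (ρ : Op (Fin n)) (p : Pair n)
    (U : gateGroup G) :
    weightSum h (applyGate ρ ((p, U) : Gate G n)) = ∑ τ : Rest p → Fin 4, ∑ α : Fin 4 × Fin 4,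
      gateCoeff (partialTrace (pauliString τ) (splitOp p ρ)) α U *
        h ((supp τ).card + pairWeight α) :=
  weightSum_applyGate h ρ ((p, U) : Gate G n)

theorem integrable_sum_gateCoeff (G : GateSet) (X : Matrix (Fin 2 × Fin 2) (Fin 2 × Fin 2) ℂ)
    (h : ℕ → ℝ) (m : ℕ) :
    Integrable (fun U : gateGroup G => ∑ α, gateCoeff X α U * h (m + pairWeight α))
      (gateMeasure G) :=
  integrable_finsetSum _ fun α _ => (integrable_gateCoeff G X α).mul_const _

theorem integral_weightSum_applyGate (G : GateSet) {n : ℕ} (h : ℕ → ℝ) (ρ : Op (Fin n))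
    (p : Pair n) :
    ∫ U : gateGroup G, weightSum h (applyGate ρ ((p, U) : Gate G n)) ∂(gateMeasure G) =
      ∑ ν, coeffSq ν ρ * pairStep h p ν := by
  simp only [weightSum_applyGate_pair]
  rw [integral_finsetSum _ fun τ _ => integrable_sum_gateCoeff G _ h _]
  simp only [integral_sum_gateCoeff]
  rw [← Equiv.sum_comp (splitEquiv p (Fin 4)).symm, Fintype.sum_prod_type_right]
  simp only [pairStep_split, coeffSq_split]

theorem integrable_weightSum_applyGate (G : GateSet) {n : ℕ} (h : ℕ → ℝ) (ρ : Op (Fin n))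
    (p : Pair n) :
    Integrable (fun U : gateGroup G => weightSum h (applyGate ρ ((p, U) : Gate G n)))
      (gateMeasure G) := by
  simp only [weightSum_applyGate_pair]
  exact integrable_finsetSum _ fun τ _ => integrable_sum_gateCoeff G _ h _

theorem sum_pairStep {n : ℕ} (hn : 2 ≤ n) (h : ℕ → ℝ) (ν : Fin n → Fin 4) :
    2 / (n * (n - 1)) * ∑ p : Pair n, pairStep h p ν = weightOp n h (supp ν).card := by
  have h2 : (2 : ℝ) ≤ n := by exact_mod_cast hn
  set l := (supp ν).card with hl
  set s : Fin n → ℝ := fun i => if ν i ≠ 0 then 1 else 0 with hs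
  have hsl : ∑ i, s i = l := by
    rw [hl, supp, Finset.card_filter]
    simp [hs]
  have hss : ∀ i, s i * s i = s i := fun i => by simp only [hs]; split_ifs <;> norm_num
  have hstep : ∀ p : Pair n, pairStep h p ν = h l +
      (s p.1.1 + s p.1.2) * (3 / 5 * (h (l + 1) - h l)) +
      (s p.1.1 * s p.1.2 + s p.1.2 * s p.1.1) *
        (1 / 5 * (h (l - 1) - h l) - 3 / 5 * (h (l + 1) - h l)) := by
    intro p
    unfold pairStep
    simp only [← hl, hs]
    by_cases h1 : ν p.1.1 = 0 <;> by_cases h2 : ν p.1.2 = 0 <;> simp [h1, h2] <;> ring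
  have hoff : ∀ F : Fin n → Fin n → ℝ, (∑ i, ∑ j, if i ≠ j then F i j else 0) =
      ∑ i, ∑ j, F i j - ∑ i, F i i := by
    intro F
    rw [← Finset.sum_sub_distrib]
    refine Finset.sum_congr rfl fun i _ => ?_
    have : ∀ j, (if i ≠ j then F i j else 0) = F i j - if i = j then F i j else 0 := by
      intro j; split_ifs <;> simp_all
    simp only [this, Finset.sum_sub_distrib, Finset.sum_ite_eq, Finset.mem_univ, if_true]
  have e1 : ∑ p : Pair n, (s p.1.1 + s p.1.2) = (n - 1) * l := by
    rw [sum_pair_add_swap (fun i _ => s i), hoff, hsl]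
    simp only [Finset.sum_const, Finset.card_univ, Fintype.card_fin, nsmul_eq_mul]
    rw [← Finset.mul_sum, hsl]
    ring
  have e2 : ∑ p : Pair n, (s p.1.1 * s p.1.2 + s p.1.2 * s p.1.1) = l * l - l := by
    rw [sum_pair_add_swap (fun i j => s i * s j), hoff, ← Finset.sum_mul_sum]
    simp only [hss, hsl]
  simp only [hstep, Finset.sum_add_distrib (f := fun p : Pair n => h l + _),
    Finset.sum_add_distrib (f := fun _ : Pair n => h l), ← Finset.sum_mul, e1, e2]
  rw [Finset.sum_const, nsmul_eq_mul, Finset.card_univ, card_pair]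
  unfold weightOp upRate downRate
  have : (n : ℝ) - 1 ≠ 0 := by linarith
  have : (n : ℝ) ≠ 0 := by linarith
  field_simp
  ring

theorem measurable_mat (G : GateSet) (n : ℕ) (x y : Fin n → Fin 2) :
    Measurable fun g : Gate G n => Gate.mat g x y := by
  have hentry : ∀ a b : Fin 2 × Fin 2, Measurable fun U : gateGroup G =>
      ((U : U4) : Matrix (Fin 2 × Fin 2) (Fin 2 × Fin 2) ℂ) a b := fun a b =>
    ((continuous_subtype_val.comp continuous_subtype_val).matrix_elem a b).measurable
  refine measurable_from_prod_countable_right fun p => ?_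
  by_cases hxy : ∀ k, k ∉ ({p.1.1, p.1.2} : Finset (Fin n)) → x k = y k
  · have e : (fun U : gateGroup G => Gate.mat ((p, U) : Gate G n) x y) =
        fun U : gateGroup G => ((U : U4) : Matrix (Fin 2 × Fin 2) (Fin 2 × Fin 2) ℂ) (x p.1.1, x p.1.2)
          (y p.1.1, y p.1.2) := funext fun U => if_pos hxy
    exact e ▸ hentry _ _
  · have e : (fun U : gateGroup G => Gate.mat ((p, U) : Gate G n) x y) = fun _ => 0 :=
      funext fun U => if_neg hxy
    exact e ▸ measurable_const

instance measurableSpace_op (ι : Type) : MeasurableSpace (Op ι) := MeasurableSpace.pi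

theorem measurable_applyGate (G : GateSet) (n : ℕ) :
    Measurable fun q : Op (Fin n) × Gate G n => applyGate q.1 q.2 := by
  refine measurable_pi_lambda _ fun x => measurable_pi_lambda _ fun y => ?_
  simp only [applyGate, Matrix.mul_apply, Matrix.conjTranspose_apply]
  have hρ : ∀ x y : Fin n → Fin 2, Measurable fun q : Op (Fin n) × Gate G n => q.1 x y :=
    fun x y => (measurable_pi_apply y).comp ((measurable_pi_apply x).comp measurable_fst)
  have hg : ∀ x y : Fin n → Fin 2, Measurable fun q : Op (Fin n) × Gate G n => Gate.mat q.2 x y :=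
    fun x y => (measurable_mat G n x y).comp measurable_snd
  exact Finset.measurable_fun_sum _ fun z _ => (Finset.measurable_fun_sum _ fun w _ =>
    (hg x w).mul (hρ w z)).mul (Complex.continuous_conj.measurable.comp (hg y z))

theorem measurable_weightSum {n : ℕ} (h : ℕ → ℝ) :
    Measurable fun ρ : Op (Fin n) => weightSum h ρ := by
  unfold weightSum coeffSq
  refine Finset.measurable_fun_sum _ fun ν _ => Measurable.mul_const (Measurable.pow_const
    (Measurable.norm ?_) 2) _
  simp only [trace_mul_eq_sum]
  have hρ : ∀ x y : Fin n → Fin 2, Measurable fun ρ : Op (Fin n) => ρ x y :=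
    fun x y => (measurable_pi_apply y).comp (measurable_pi_apply x)
  exact Finset.measurable_fun_sum _ fun q _ => (hρ q.2 q.1).const_mul _

theorem card_supp_le {n : ℕ} (ν : Fin n → Fin 4) : (supp ν).card ≤ n := by
  simpa using Finset.card_le_univ (supp ν)

theorem weightSum_nonneg {n : ℕ} {h : ℕ → ℝ} (hh : ∀ l ≤ n, 0 ≤ h l) (ρ : Op (Fin n)) :
    0 ≤ weightSum h ρ :=
  Finset.sum_nonneg fun ν _ => mul_nonneg (coeffSq_nonneg ν ρ) (hh _ (card_supp_le ν))

/-- A random gate acts on the Pauli weight distribution by the weight chain. -/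
theorem lintegral_weightSum_applyGate (G : GateSet) {n : ℕ} (hn : 2 ≤ n) {h : ℕ → ℝ}
    (hh : ∀ l ≤ n, 0 ≤ h l) (ρ : Op (Fin n)) :
    ∫⁻ g : Gate G n, ENNReal.ofReal (weightSum h (applyGate ρ g))
      ∂((uniformOn (Set.univ : Set (Pair n))).prod (gateMeasure G)) =
      ENNReal.ofReal (weightSum (weightOp n h) ρ) := by
  have hmeas : Measurable fun g : Gate G n => ENNReal.ofReal (weightSum h (applyGate ρ g)) :=
    ((measurable_weightSum h).comp ((measurable_applyGate G n).comp
      (measurable_const.prodMk measurable_id))).ennreal_ofReal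
  rw [lintegral_prod _ hmeas.aemeasurable]
  have hp : ∀ p : Pair n, ∫⁻ U : gateGroup G,
      ENNReal.ofReal (weightSum h (applyGate ρ ((p, U) : Gate G n))) ∂(gateMeasure G) =
      ENNReal.ofReal (∑ ν, coeffSq ν ρ * pairStep h p ν) := by
    intro p
    rw [← integral_weightSum_applyGate G, ofReal_integral_eq_lintegral_ofReal
      (integrable_weightSum_applyGate G h ρ p)
      (Filter.Eventually.of_forall fun U => weightSum_nonneg hh _)]
  simp only [hp]
  rw [lintegral_uniformOn_pair hn]
  · congr 1
    rw [Finset.sum_comm, Finset.mul_sum, weightSum]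
    refine Finset.sum_congr rfl fun ν _ => ?_
    rw [← Finset.mul_sum, mul_left_comm, sum_pairStep hn]
  · intro p
    rw [← integral_weightSum_applyGate G]
    exact integral_nonneg fun U => weightSum_nonneg hh _

/-- The expected scrambling error is bounded in terms of the weight chain. -/
theorem lintegral_scramblingError_le (G : GateSet) {n : ℕ} (hn : 2 ≤ n) (t : ℕ)
    {ρ : Op (Fin n)} (ht : ρ.trace = 1) (S : Finset (Fin n)) :
    ∫⁻ ω, ENNReal.ofReal (scramblingError S (output ω ρ)) ∂(circuitMeasure G n t) ≤
      ENNReal.ofReal (weightSum (lowProb n S.card t) ρ) := by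
  have h1 : ∀ ω : Fin t → Gate G n, ENNReal.ofReal (scramblingError S (output ω ρ)) ≤
      ENNReal.ofReal (weightSum (lowProb n S.card 0) ((List.ofFn ω).foldl applyGate ρ)) := by
    intro ω
    rw [output_eq_foldl]
    exact ENNReal.ofReal_le_ofReal (scramblingError_le S (by rw [trace_foldl_applyGate, ht]))
  refine (lintegral_mono h1).trans ?_
  exact lintegral_pi_foldl_le ((uniformOn (Set.univ : Set (Pair n))).prod (gateMeasure G))
    (measurable_applyGate G n)
    (Φ := fun ρ => ENNReal.ofReal (weightSum (lowProb n S.card 0) ρ))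
    (measurable_weightSum _).ennreal_ofReal
    (U := fun t ρ => ENNReal.ofReal (weightSum (lowProb n S.card t) ρ))
    (fun _ => le_rfl)
    (fun t ρ => by
      rw [lintegral_weightSum_applyGate G hn (lowProb_nonneg hn _ t), lowProb_succ]) t ρ

/-! ### Estimates for the weight chain -/

theorem weightSum_le_of_survival_le {n m s t : ℕ} (hn : 2 ≤ n) (hm : m ≤ n) (hs : s < m) {A : ℝ}
    (hA : 0 ≤ A) (hsurv : ∀ l, 1 ≤ l → l < m → survival n m t l ≤ A * decay n l)
    {ρ : Op (Fin n)} (hρ : ρ.PosSemidef) (ht : ρ.trace = 1) :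
    weightSum (lowProb n s t) ρ ≤
      2 ^ n * ((∑ k ∈ Finset.range (s + 1), paulis n k) / paulis n m) + n * A := by
  set ε := (∑ k ∈ Finset.range (s + 1), paulis n k) / paulis n m with hε
  have hε0 : 0 ≤ ε := div_nonneg (Finset.sum_nonneg fun k _ => by unfold paulis; positivity)
    (by unfold paulis; positivity)
  have h1 : weightSum (lowProb n s t) ρ ≤ ∑ ν : Fin n → Fin 4, coeffSq ν ρ * ε +
      ∑ ν : Fin n → Fin 4, coeffSq ν ρ * survival n m t (supp ν).card := by
    rw [← Finset.sum_add_distrib]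
    refine Finset.sum_le_sum fun ν _ => ?_
    rw [← mul_add]
    exact mul_le_mul_of_nonneg_left (lowProb_le_add_survival hn hm hs t _ (card_supp_le ν))
      (coeffSq_nonneg ν ρ)
  have h2 : ∑ ν : Fin n → Fin 4, coeffSq ν ρ * ε ≤ 2 ^ n * ε := by
    rw [← Finset.sum_mul]
    exact mul_le_mul_of_nonneg_right (sum_coeffSq_le hρ ht) hε0
  have h3 : ∑ ν : Fin n → Fin 4, coeffSq ν ρ * survival n m t (supp ν).card ≤ n * A := by
    have hmaps : ∀ ν ∈ (Finset.univ : Finset (Fin n → Fin 4)),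
        (supp ν).card ∈ Finset.range (n + 1) := fun ν _ =>
      Finset.mem_range.mpr (Nat.lt_succ_of_le (card_supp_le ν))
    rw [← Finset.sum_fiberwise_of_maps_to hmaps]
    have hl : ∀ l ∈ Finset.range (n + 1),
        ∑ ν ∈ Finset.univ.filter (fun ν : Fin n → Fin 4 => (supp ν).card = l),
          coeffSq ν ρ * survival n m t (supp ν).card ≤ if l ∈ Finset.range m then A else 0 := by
      intro l hl
      have e : ∑ ν ∈ Finset.univ.filter (fun ν : Fin n → Fin 4 => (supp ν).card = l),
          coeffSq ν ρ * survival n m t (supp ν).card =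
          (∑ ν ∈ Finset.univ.filter (fun ν : Fin n → Fin 4 => (supp ν).card = l),
            coeffSq ν ρ) * survival n m t l := by
        rw [Finset.sum_mul]
        exact Finset.sum_congr rfl fun ν hν => by rw [(Finset.mem_filter.mp hν).2]
      rw [e]
      by_cases h : 1 ≤ l ∧ l < m
      · rw [if_pos (Finset.mem_range.mpr h.2)]
        have hd := decay_pos (n := n) (l := l) (by omega)
        have hone : (2 ^ l * n.choose l : ℝ) * decay n l = 1 := by
          unfold decay at hd ⊢
          exact mul_inv_cancel₀ (inv_pos.mp hd).ne'
        calc _ ≤ (∑ ν ∈ Finset.univ.filter (fun ν : Fin n → Fin 4 => (supp ν).card = l),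
                coeffSq ν ρ) * (A * decay n l) :=
              mul_le_mul_of_nonneg_left (hsurv l h.1 h.2)
                (Finset.sum_nonneg fun ν _ => coeffSq_nonneg ν ρ)
          _ ≤ (2 ^ l * n.choose l) * (A * decay n l) :=
              mul_le_mul_of_nonneg_right (sum_coeffSq_card_supp_le hρ ht l) (by positivity)
          _ = A := by linear_combination A * hone
      · rw [survival_of_not h, mul_zero]
        split_ifs <;> simp [hA]
    refine (Finset.sum_le_sum hl).trans ?_
    rw [← Finset.sum_filter]
    have hsub : (Finset.range (n + 1)).filter (fun l => l ∈ Finset.range m) ⊆ Finset.range n := by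
      intro l
      simp only [Finset.mem_filter, Finset.mem_range]
      omega
    calc _ ≤ ∑ l ∈ Finset.range n, A :=
          Finset.sum_le_sum_of_subset_of_nonneg hsub fun _ _ _ => hA
      _ = n * A := by simp
  linarith

/-- After `c n log² n` steps, the weight chain has left the weights below `n / 2`. -/
theorem survival_le_of_le {n b t : ℕ} (hn : 52 ≤ n) (hb : 20 * (b + 2) ≤ n)
    (ht : 160 * (b + 2) * n * Real.log n ^ 2 ≤ t) (l : ℕ) (hl : l ≤ n) :
    survival n (n / 2) t l ≤ 3 / n ^ b * decay n l := by
  have hnr : (52 : ℝ) ≤ n := by exact_mod_cast hn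
  have hn0 : (0 : ℝ) < n := by linarith
  have hbr : (20 : ℝ) * (b + 2) ≤ n := by exact_mod_cast hb
  set L := Real.log n with hL
  have hL1 : 1 ≤ L := by
    rw [hL, Real.le_log_iff_exp_le hn0]
    linarith [Real.exp_one_lt_d9]
  have hLn : L ≤ n := by linarith [Real.log_le_sub_one_of_pos hn0]
  have hexpL : Real.exp L = n := Real.exp_log hn0
  set κ : ℝ := 1 / (20 * (b + 2) * n * L) with hκ
  have hden : (0 : ℝ) < 20 * (b + 2) * n * L := by positivity
  have hκ0 : 0 < κ := by positivity
  have hκ1 : κ ≤ 1 := by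
    rw [hκ, div_le_one hden]
    have h1 : (1 : ℝ) ≤ 20 * (b + 2) := by
      have : (0 : ℝ) ≤ b := Nat.cast_nonneg b
      linarith
    have h2 : (1 : ℝ) ≤ n := by linarith
    calc (1 : ℝ) = 1 * 1 * 1 := by norm_num
      _ ≤ 20 * (b + 2) * n * L := by gcongr
  have hlow : ∀ l : ℕ, 1 ≤ l → l < n / 2 → ∀ S : ℝ, l ≤ κ * S →
      (n : ℝ) ^ b ≤ Real.exp (S / (20 * n)) * decay n l := by
    intro l h1 h2 S hS
    have hS' : ((b + 2) * l : ℕ) * L ≤ S / (20 * n) := by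
      rw [hκ, one_div_mul_eq_div, le_div_iff₀ hden] at hS
      rw [le_div_iff₀ (by positivity)]
      push_cast
      linarith
    have hexp : (n : ℝ) ^ ((b + 2) * l) ≤ Real.exp (S / (20 * n)) := by
      rw [← hexpL, ← Real.exp_nat_mul, hexpL]
      exact Real.exp_le_exp.mpr hS'
    have hB0 : (0 : ℝ) < 2 ^ l * n.choose l := by
      have := Nat.choose_pos (n := n) (k := l) (by omega)
      positivity
    have hB : (2 ^ l * n.choose l : ℝ) ≤ (n : ℝ) ^ (2 * l) := by
      rw [two_mul, pow_add]
      have : (n.choose l : ℝ) ≤ (n : ℝ) ^ l := by exact_mod_cast Nat.choose_le_pow n l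
      gcongr
      linarith
    unfold decay
    rw [← div_eq_mul_inv, le_div_iff₀ hB0]
    calc (n : ℝ) ^ b * (2 ^ l * n.choose l) ≤ (n : ℝ) ^ (b * l) * (n : ℝ) ^ (2 * l) := by
          gcongr
          · linarith
          · exact Nat.le_mul_of_pos_right b h1
      _ = (n : ℝ) ^ ((b + 2) * l) := by rw [← pow_add]; congr 1; ring
      _ ≤ _ := hexp
  have hSmax : (n : ℝ) / κ ≤ (1 + κ) ^ t * 1 := by
    have h1 : Real.exp (κ / 2) ≤ 1 + κ := by
      have h2 : 1 - κ / 2 ≤ Real.exp (-(κ / 2)) := by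
        linarith [Real.add_one_le_exp (-(κ / 2))]
      have h3 : Real.exp (κ / 2) * Real.exp (-(κ / 2)) = 1 := by
        rw [← Real.exp_add]; simp
      have h4 := Real.exp_pos (κ / 2)
      have h5 : Real.exp (κ / 2) * (1 - κ / 2) ≤ 1 := by nlinarith
      nlinarith
    have h2 : 4 * L ≤ t * (κ / 2) := by
      have : κ / 2 = 1 / (40 * (b + 2) * n * L) := by rw [hκ]; field_simp; norm_num
      rw [this, mul_one_div, le_div_iff₀ (by positivity)]
      calc 4 * L * (40 * (b + 2) * n * L) = 160 * (b + 2) * n * L ^ 2 := by ring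
        _ ≤ t := ht
    have h3 : (n : ℝ) ^ 4 ≤ (1 + κ) ^ t := by
      calc (n : ℝ) ^ 4 = Real.exp (4 * L) := by
            rw [← hexpL, ← Real.exp_nat_mul]; norm_num
        _ ≤ Real.exp (t * (κ / 2)) := Real.exp_le_exp.mpr h2
        _ = Real.exp (κ / 2) ^ t := by rw [Real.exp_nat_mul]
        _ ≤ (1 + κ) ^ t := pow_le_pow_left₀ (Real.exp_pos _).le h1 t
    rw [mul_one]
    refine le_trans ?_ h3
    calc (n : ℝ) / κ = n * (20 * (b + 2) * n * L) := by rw [hκ]; field_simp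
      _ ≤ n * (n * n * n) := by gcongr
      _ = (n : ℝ) ^ 4 := by ring
  have hK : (0 : ℝ) < (n : ℝ) ^ b := by positivity
  have := survival_le (m := n / 2) hn (by omega) hK hκ0 hlow
    (fun l h1 h2 S hS => hlow l h1 h2 S (by
      rw [div_le_iff₀ hκ0] at hS
      have : (l : ℝ) ≤ n := by exact_mod_cast (by omega : l ≤ n)
      linarith)) t l hl 1 hSmax
  refine this.trans ?_
  have hd := decay_pos hl
  have he : Real.exp (1 / (20 * n)) ≤ 3 := by
    have h1 : 1 / (20 * (n : ℝ)) ≤ 1 := by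
      rw [div_le_one (by positivity)]
      linarith
    linarith [Real.exp_le_exp.mpr h1, Real.exp_one_lt_d9]
  calc Real.exp (1 / (20 * n)) * decay n l / n ^ b ≤ 3 * decay n l / n ^ b := by gcongr
    _ = _ := by ring

theorem entropy_nonneg {f : ℝ} (h0 : 0 ≤ f) (h1 : f ≤ 1) : 0 ≤ entropy f := by
  have e1 := Real.logb_nonpos (b := 2) (by norm_num) h0 h1
  have e2 := Real.logb_nonpos (b := 2) (by norm_num) (x := 1 - f) (by linarith) (by linarith)
  unfold entropy
  nlinarith

theorem lt_half_of_entropy_lt {f : ℝ} (h0 : 0 ≤ f) (h1 : f ≤ 1)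
    (hf : f * Real.logb 2 3 + entropy f - Real.logb 2 3 / 2 < 0) : f < 1 / 2 := by
  have e1 := entropy_nonneg h0 h1
  have e2 : 0 < Real.logb 2 3 := Real.logb_pos (by norm_num) (by norm_num)
  by_contra h
  push Not at h
  nlinarith

/-- The Chernoff bound for the number of Pauli strings of low weight. -/
theorem sum_paulis_le {n s : ℕ} {f : ℝ} (h0 : 0 ≤ f) (h1 : f < 1 / 2) (hsn : s ≤ n)
    (hs : (s : ℝ) ≤ f * n) : ∑ k ∈ Finset.range (s + 1), paulis n k ≤
      (2 : ℝ) ^ ((f * Real.logb 2 3 + entropy f) * n) := by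
  rcases h0.eq_or_lt with rfl | hf
  · have : s = 0 := by
      have : (s : ℝ) ≤ 0 := by simpa using hs
      exact_mod_cast le_antisymm this (Nat.cast_nonneg s)
    simp [this, paulis, entropy]
  set x : ℝ := f / (3 * (1 - f)) with hx
  have hf1 : 0 < 1 - f := by linarith
  have hx0 : 0 < x := by positivity
  have hx1 : x ≤ 1 := by
    rw [hx, div_le_one (by positivity)]
    linarith
  have hrhs : (2 : ℝ) ^ ((f * Real.logb 2 3 + entropy f) * n) = x ^ (-(f * n)) * (1 + 3 * x) ^ n := by
    have e1 : 1 + 3 * x = (1 - f)⁻¹ := by rw [hx]; field_simp; ring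
    have e2 : x = (2 : ℝ) ^ Real.logb 2 x :=
      (Real.rpow_logb (by norm_num) (by norm_num) hx0).symm
    have e3 : (1 - f)⁻¹ = (2 : ℝ) ^ (-Real.logb 2 (1 - f)) := by
      rw [Real.rpow_neg (by norm_num), Real.rpow_logb (by norm_num) (by norm_num) hf1]
    have e4 : Real.logb 2 x = Real.logb 2 f - (Real.logb 2 3 + Real.logb 2 (1 - f)) := by
      rw [hx, Real.logb_div hf.ne' (by positivity), Real.logb_mul (by norm_num) hf1.ne']
    rw [e1, e3, e2, e4, ← Real.rpow_mul (by norm_num), ← Real.rpow_natCast,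
      ← Real.rpow_mul (by norm_num), ← Real.rpow_add (by norm_num)]
    congr 1
    unfold entropy
    ring
  rw [hrhs]
  have hbinom : (1 + 3 * x) ^ n = ∑ k ∈ Finset.range (n + 1), paulis n k * x ^ k := by
    rw [add_comm, add_pow]
    refine Finset.sum_congr rfl fun k _ => ?_
    unfold paulis
    rw [mul_pow, one_pow]
    ring
  have hnn : ∀ k, 0 ≤ paulis n k := fun k => by unfold paulis; positivity
  rw [hbinom, Finset.mul_sum]
  calc ∑ k ∈ Finset.range (s + 1), paulis n k
      ≤ ∑ k ∈ Finset.range (s + 1), x ^ (-(f * n)) * (paulis n k * x ^ k) := by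
        refine Finset.sum_le_sum fun k hk => ?_
        have hk' : (k : ℝ) ≤ f * n := by
          refine le_trans ?_ hs
          exact_mod_cast Nat.lt_succ_iff.mp (Finset.mem_range.mp hk)
        have : (1 : ℝ) ≤ x ^ (-(f * n)) * x ^ k := by
          rw [← Real.rpow_natCast, ← Real.rpow_add hx0]
          exact Real.one_le_rpow_of_pos_of_le_one_of_nonpos hx0 hx1 (by linarith)
        calc paulis n k = paulis n k * 1 := (mul_one _).symm
          _ ≤ paulis n k * (x ^ (-(f * n)) * x ^ k) := mul_le_mul_of_nonneg_left this (hnn k)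
          _ = _ := by ring
    _ ≤ _ := by
        refine Finset.sum_le_sum_of_subset_of_nonneg
          (Finset.range_subset_range.mpr (by omega)) fun k _ _ => ?_
        have := hnn k
        positivity

theorem two_pow_mul_sum_paulis_le {n s : ℕ} {f : ℝ} (h0 : 0 ≤ f) (h1 : f < 1 / 2) (hsn : s ≤ n)
    (hs : (s : ℝ) ≤ f * n) :
    2 ^ n * ((∑ k ∈ Finset.range (s + 1), paulis n k) / paulis n (n / 2)) ≤
      2 * (n + 1) *
        (2 : ℝ) ^ ((f * Real.logb 2 3 + entropy f - Real.logb 2 3 / 2) * n) := by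
  have hmid : (2 : ℝ) ^ n ≤ (n + 1) * n.choose (n / 2) := by
    have h : 2 ^ n ≤ (n + 1) * n.choose (n / 2) := by
      rw [← Nat.sum_range_choose]
      refine (Finset.sum_le_sum fun k _ => Nat.choose_le_middle k n).trans_eq ?_
      simp
    exact_mod_cast h
  have h3 : (3 : ℝ) ^ ((n : ℝ) / 2) ≤ 2 * 3 ^ (n / 2) := by
    have e : ((n : ℝ)) / 2 ≤ (n / 2 : ℕ) + 1 / 2 := by
      have : n ≤ 2 * (n / 2) + 1 := by omega
      have : (n : ℝ) ≤ 2 * (n / 2 : ℕ) + 1 := by exact_mod_cast this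
      linarith
    calc (3 : ℝ) ^ ((n : ℝ) / 2) ≤ 3 ^ (((n / 2 : ℕ) : ℝ) + 1 / 2) :=
          Real.rpow_le_rpow_of_exponent_le (by norm_num) e
      _ = 3 ^ (n / 2) * Real.sqrt 3 := by
          rw [Real.rpow_add (by norm_num), Real.rpow_natCast, ← Real.sqrt_eq_rpow]
      _ ≤ 3 ^ (n / 2) * 2 := by
          refine mul_le_mul_of_nonneg_left ?_ (by positivity)
          rw [Real.sqrt_le_left (by norm_num)]
          norm_num
      _ = _ := by ring
  have hsum := sum_paulis_le h0 h1 hsn hs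
  have hc : (0 : ℝ) < n.choose (n / 2) := by
    exact_mod_cast Nat.choose_pos (Nat.div_le_self n 2)
  have hsplit : (2 : ℝ) ^ ((f * Real.logb 2 3 + entropy f - Real.logb 2 3 / 2) * n) =
      (2 : ℝ) ^ ((f * Real.logb 2 3 + entropy f) * n) / (3 : ℝ) ^ ((n : ℝ) / 2) := by
    have : (3 : ℝ) ^ ((n : ℝ) / 2) = (2 : ℝ) ^ (Real.logb 2 3 * ((n : ℝ) / 2)) := by
      rw [Real.rpow_mul (by norm_num), Real.rpow_logb (by norm_num) (by norm_num) (by norm_num)]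
    rw [this, ← Real.rpow_sub (by norm_num)]
    congr 1
    ring
  rw [hsplit]
  set E := (2 : ℝ) ^ ((f * Real.logb 2 3 + entropy f) * n) with hE
  have hE0 : 0 < E := by positivity
  unfold paulis at hsum ⊢
  calc _ ≤ ((n + 1) * n.choose (n / 2)) * (E / (3 ^ (n / 2) * n.choose (n / 2))) := by
        refine mul_le_mul hmid ?_ (div_nonneg (Finset.sum_nonneg fun k _ => by positivity)
          (by positivity)) (by positivity)
        gcongr
    _ = 2 * (n + 1) * (E / (2 * 3 ^ (n / 2))) := by field_simp
    _ ≤ 2 * (n + 1) * (E / (3 : ℝ) ^ ((n : ℝ) / 2)) := by gcongr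

theorem eventually_exp_small (a : ℕ) {δ : ℝ} (hδ : 0 < δ) :
    ∀ᶠ n : ℕ in Filter.atTop,
      2 * ((n : ℝ) + 1) * (2 : ℝ) ^ (-δ * n) ≤ 1 / 4 * (1 / (n : ℝ) ^ a) := by
  have hb : 0 < δ * Real.log 2 := mul_pos hδ (Real.log_pos (by norm_num))
  have h1 := (Real.tendsto_pow_mul_exp_neg_atTop_nhds_zero (a + 1)).comp
    (tendsto_natCast_atTop_atTop.const_mul_atTop hb : Filter.Tendsto
      (fun n : ℕ => δ * Real.log 2 * (n : ℝ)) Filter.atTop Filter.atTop)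
  have hpos : (0 : ℝ) < (δ * Real.log 2) ^ (a + 1) / 16 := by positivity
  filter_upwards [h1.eventually (gt_mem_nhds hpos), Filter.eventually_ge_atTop 1] with n hn hn1
  have hnr : (1 : ℝ) ≤ n := by exact_mod_cast hn1
  have e : (2 : ℝ) ^ (-δ * n) = Real.exp (-(δ * Real.log 2 * n)) := by
    rw [Real.rpow_def_of_pos (by norm_num)]; congr 1; ring
  rw [e]
  simp only [Function.comp] at hn
  rw [mul_pow, mul_assoc, div_eq_mul_one_div] at hn
  have hn' := lt_of_mul_lt_mul_left hn (by positivity)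
  have hna : (0 : ℝ) < (n : ℝ) ^ a := by positivity
  rw [mul_one_div, le_div_iff₀ hna]
  have hex := Real.exp_pos (-(δ * Real.log 2 * n))
  calc 2 * ((n : ℝ) + 1) * Real.exp (-(δ * Real.log 2 * n)) * (n : ℝ) ^ a
      ≤ 2 * (n + n) * Real.exp (-(δ * Real.log 2 * n)) * (n : ℝ) ^ a := by gcongr
    _ = 4 * ((n : ℝ) ^ (a + 1) * Real.exp (-(δ * Real.log 2 * n))) := by ring
    _ ≤ 1 / 4 := by linarith

/-! ### Depth and conditioning -/

theorem depth_bound_le {n t a : ℕ} (hn : 2 ≤ n) {c' : ℝ} (hc' : 0 ≤ c')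
    (ht : (t : ℝ) ≤ c' * n * Real.logb 2 n ^ 2) :
    (1 + 8 / (n : ℝ)) ^ t * n / (2 : ℝ) ^ ((16 * c' + a + 2) * Real.logb 2 n ^ 3) ≤
      1 / 2 * (1 / (n : ℝ) ^ a) := by
  have hnr : (2 : ℝ) ≤ n := by exact_mod_cast hn
  have hn0 : (0 : ℝ) < n := by linarith
  set x := Real.logb 2 n with hx
  have hx1 : 1 ≤ x := by
    rw [hx, Real.le_logb_iff_rpow_le (by norm_num) hn0]
    simpa using hnr
  have hn2 : (n : ℝ) = (2 : ℝ) ^ x := (Real.rpow_logb (by norm_num) (by norm_num) hn0).symm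
  have h1 : (1 + 8 / (n : ℝ)) ^ t ≤ (2 : ℝ) ^ (16 * c' * x ^ 2) := by
    have e1 : 1 + 8 / (n : ℝ) ≤ (2 : ℝ) ^ (16 / (n : ℝ)) := by
      have e2 : Real.exp (8 / (n : ℝ)) ≤ (2 : ℝ) ^ (16 / (n : ℝ)) := by
        rw [Real.rpow_def_of_pos (by norm_num)]
        apply Real.exp_le_exp.mpr
        have : (1 : ℝ) / 2 ≤ Real.log 2 := by linarith [Real.log_two_gt_d9]
        calc 8 / (n : ℝ) = 1 / 2 * (16 / n) := by ring
          _ ≤ Real.log 2 * (16 / n) := by gcongr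
      linarith [Real.add_one_le_exp (8 / (n : ℝ))]
    calc (1 + 8 / (n : ℝ)) ^ t ≤ ((2 : ℝ) ^ (16 / (n : ℝ))) ^ t :=
          pow_le_pow_left₀ (by positivity) e1 t
      _ = (2 : ℝ) ^ (16 / (n : ℝ) * t) := by
          rw [← Real.rpow_natCast, ← Real.rpow_mul (by norm_num)]
      _ ≤ (2 : ℝ) ^ (16 * c' * x ^ 2) := by
          apply Real.rpow_le_rpow_of_exponent_le (by norm_num)
          calc 16 / (n : ℝ) * t ≤ 16 / n * (c' * n * x ^ 2) := by gcongr
            _ = _ := by field_simp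
  have hx2 : x ^ 2 ≤ x ^ 3 := pow_le_pow_right₀ hx1 (by norm_num)
  have hx3 : x ≤ x ^ 3 := le_self_pow₀ hx1 (by norm_num)
  have hrhs : 1 / 2 * (1 / (n : ℝ) ^ a) = (2 : ℝ) ^ (-1 - a * x) := by
    rw [Real.rpow_sub (by norm_num), mul_comm (a : ℝ) x, Real.rpow_mul (by norm_num), ← hn2,
      Real.rpow_natCast, Real.rpow_neg_one]
    ring
  rw [hrhs, div_le_iff₀ (by positivity), ← Real.rpow_add (by norm_num)]
  calc (1 + 8 / (n : ℝ)) ^ t * n ≤ (2 : ℝ) ^ (16 * c' * x ^ 2) * (2 : ℝ) ^ x :=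
        mul_le_mul h1 hn2.le hn0.le (by positivity)
    _ = (2 : ℝ) ^ (16 * c' * x ^ 2 + x) := by rw [← Real.rpow_add (by norm_num)]
    _ ≤ _ := by
        apply Real.rpow_le_rpow_of_exponent_le (by norm_num)
        have ha : (0 : ℝ) ≤ a := Nat.cast_nonneg a
        nlinarith [mul_le_mul_of_nonneg_left hx2 hc', mul_le_mul_of_nonneg_left hx3 ha]

theorem lintegral_cond_le {Ω : Type*} [MeasurableSpace Ω] (μ : Measure Ω) [IsProbabilityMeasure μ]
    {s : Set Ω} (hs : μ sᶜ ≤ 1 / 2) (F : Ω → ℝ≥0∞) :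
    ∫⁻ ω, F ω ∂(ProbabilityTheory.cond μ s) ≤ 2 * ∫⁻ ω, F ω ∂μ := by
  have h1 : (1 : ℝ≥0∞) / 2 ≤ μ s := by
    have h2 : (1 : ℝ≥0∞) ≤ μ s + μ sᶜ := by
      rw [← measure_univ (μ := μ), ← Set.union_compl_self s]
      exact measure_union_le s sᶜ
    have h3 : (1 : ℝ≥0∞) / 2 + 1 / 2 ≤ μ s + 1 / 2 := by
      rw [ENNReal.add_halves]
      exact h2.trans (add_le_add le_rfl hs)
    exact (ENNReal.add_le_add_iff_right (by simp)).mp h3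
  rw [ProbabilityTheory.cond, lintegral_smul_measure, smul_eq_mul]
  refine mul_le_mul' ?_ (lintegral_mono' Measure.restrict_le_self le_rfl)
  rw [ENNReal.inv_le_iff_inv_le]
  simpa using h1

theorem isProbabilityMeasure_circuitMeasure (G : GateSet) {n : ℕ} (hn : 2 ≤ n) (t : ℕ) :
    IsProbabilityMeasure (circuitMeasure G n t) := by
  have := nonempty_pair hn
  have : IsProbabilityMeasure (uniformOn (Set.univ : Set (Pair n))) :=
    isProbabilityMeasure_uniformOn Set.finite_univ Set.univ_nonempty
  unfold circuitMeasure
  infer_instance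

theorem weightSum_lowProb_le (a : ℕ) {n s t : ℕ} {f : ℝ} (hn : 52 ≤ n) (hb : 20 * (a + 5) ≤ n)
    (h0 : 0 ≤ f) (h1 : f < 1 / 2) (hfn : 2 ≤ (1 / 2 - f) * n) (hs : (s : ℝ) ≤ f * n)
    (ht : 160 * (a + 5) * n * Real.logb 2 n ^ 2 ≤ t)
    (hsmall : 2 * ((n : ℝ) + 1) *
      (2 : ℝ) ^ ((f * Real.logb 2 3 + entropy f - Real.logb 2 3 / 2) * n) ≤
        1 / 4 * (1 / (n : ℝ) ^ a))
    {ρ : Op (Fin n)} (hρ : ρ.PosSemidef) (htr : ρ.trace = 1) :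
    weightSum (lowProb n s t) ρ ≤ 1 / 2 * (1 / (n : ℝ) ^ a) := by
  have hnr : (52 : ℝ) ≤ n := by exact_mod_cast hn
  have hn0 : (0 : ℝ) < n := by linarith
  have hsm : s < n / 2 := by
    have e : (s : ℝ) + 2 ≤ n / 2 := by linarith
    have : 2 * s + 4 ≤ n := by
      have : 2 * (s : ℝ) + 4 ≤ n := by linarith
      exact_mod_cast this
    omega
  have hlog : Real.log n ≤ Real.logb 2 n := by
    have hl : 0 ≤ Real.log n := Real.log_nonneg (by linarith)
    rw [Real.logb, le_div_iff₀ (Real.log_pos (by norm_num))]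
    have : Real.log 2 ≤ 1 := by linarith [Real.log_two_lt_d9]
    nlinarith
  have ht' : 160 * (((a + 3 : ℕ) : ℝ) + 2) * n * Real.log n ^ 2 ≤ t := by
    refine le_trans ?_ ht
    have hl : 0 ≤ Real.log n := Real.log_nonneg (by linarith)
    push_cast
    have : (a : ℝ) + 3 + 2 = a + 5 := by ring
    rw [this]
    gcongr
  have hmain := weightSum_le_of_survival_le (n := n) (m := n / 2) (t := t) (by omega)
    (Nat.div_le_self n 2) hsm (A := 3 / (n : ℝ) ^ (a + 3)) (by positivity)
    (fun l _ hl => survival_le_of_le hn (by omega) ht' l (by omega)) hρ htr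
  have heps := (two_pow_mul_sum_paulis_le h0 h1 (by omega) hs).trans hsmall
  have hA : (n : ℝ) * (3 / (n : ℝ) ^ (a + 3)) ≤ 1 / 4 * (1 / (n : ℝ) ^ a) := by
    have e : (n : ℝ) * (3 / (n : ℝ) ^ (a + 3)) = 3 / n ^ 2 * (1 / (n : ℝ) ^ a) := by
      rw [pow_add]
      field_simp
    rw [e]
    refine mul_le_mul_of_nonneg_right ?_ (by positivity)
    rw [div_le_iff₀ (by positivity)]
    nlinarith
  linarith

end

end RQC

theorem mainTheorem7 (G : RQC.GateSet) (a : ℕ) :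
    ∃ c : ℝ, 0 < c ∧ ∀ c' : ℝ, c ≤ c' → ∃ C : ℝ, 0 < C ∧
      ∀ f : ℝ, 0 ≤ f → f ≤ 1 →
        f * Real.logb 2 3 + RQC.entropy f - Real.logb 2 3 / 2 < 0 →
      ∃ n₀ : ℕ, ∀ n : ℕ, n₀ ≤ n → ∀ t : ℕ,
        c * n * Real.logb 2 n ^ 2 ≤ t → (t : ℝ) ≤ c' * n * Real.logb 2 n ^ 2 →
        -- the parallelized circuit has depth at most `C log³ n`, with high probability
        RQC.circuitMeasure G n t {ω | C * Real.logb 2 n ^ 3 < (RQC.depth ω : ℝ)} ≤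
            ENNReal.ofReal (1 / (n : ℝ) ^ a) ∧
        ∀ ρ : RQC.Op (Fin n), ρ.PosSemidef → ρ.trace = 1 →
        ∀ S : Finset (Fin n), (S.card : ℝ) ≤ f * n →
          -- expectation over the parallelized circuit of `t` random gates
          ∫⁻ ω, ENNReal.ofReal (RQC.scramblingError S (RQC.output ω ρ))
              ∂(RQC.circuitMeasure G n t) ≤ ENNReal.ofReal (1 / (n : ℝ) ^ a) ∧
          -- the same expectation over the circuits of depth at most `C log³ n` only
          ∫⁻ ω, ENNReal.ofReal (RQC.scramblingError S (RQC.output ω ρ))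
              ∂(ProbabilityTheory.cond (RQC.circuitMeasure G n t)
                {ω | (RQC.depth ω : ℝ) ≤ C * Real.logb 2 n ^ 3}) ≤
            ENNReal.ofReal (1 / (n : ℝ) ^ a) := by
  refine ⟨160 * (a + 5), by positivity, fun c' hc' => ?_⟩
  have hc'0 : 0 ≤ c' := le_trans (by positivity) hc'
  refine ⟨16 * c' + a + 2, by positivity, fun f hf0 hf1 hf => ?_⟩
  have hhalf := RQC.lt_half_of_entropy_lt hf0 hf1 hf
  have hev1 := RQC.eventually_exp_small a (neg_pos.mpr hf)
  have hev2 : ∀ᶠ n : ℕ in Filter.atTop, 2 ≤ (1 / 2 - f) * (n : ℝ) :=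
    (tendsto_natCast_atTop_atTop.const_mul_atTop (by linarith)).eventually_ge_atTop 2
  obtain ⟨n₀, hn₀⟩ := Filter.eventually_atTop.mp (hev1.and hev2)
  refine ⟨max n₀ (max 52 (20 * (a + 5))), fun n hn t ht ht' => ?_⟩
  obtain ⟨hsmall, hfn⟩ := hn₀ n (le_trans (le_max_left _ _) hn)
  rw [neg_neg] at hsmall
  have hn52 : 52 ≤ n := by omega
  have hnb : 20 * (a + 5) ≤ n := by omega
  have hna : (0 : ℝ) < (n : ℝ) ^ a := by
    have : (0 : ℝ) < n := by exact_mod_cast (by omega : 0 < n)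
    positivity
  have hhalf_le : 1 / 2 * (1 / (n : ℝ) ^ a) ≤ 1 / (n : ℝ) ^ a := by
    have : 0 < 1 / (n : ℝ) ^ a := by positivity
    linarith
  have hprob := RQC.isProbabilityMeasure_circuitMeasure G (by omega : 2 ≤ n) t
  have hdepth : RQC.circuitMeasure G n t
      {ω | (16 * c' + a + 2) * Real.logb 2 n ^ 3 < (RQC.depth ω : ℝ)} ≤
        ENNReal.ofReal (1 / 2 * (1 / (n : ℝ) ^ a)) :=
    (RQC.circuitMeasure_depth_gt_le G (by omega) t _).trans
      (ENNReal.ofReal_le_ofReal (RQC.depth_bound_le (by omega) hc'0 ht'))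
  refine ⟨hdepth.trans (ENNReal.ofReal_le_ofReal hhalf_le), fun ρ hρ htr S hS => ?_⟩
  have hexp : ∫⁻ ω, ENNReal.ofReal (RQC.scramblingError S (RQC.output ω ρ))
      ∂(RQC.circuitMeasure G n t) ≤ ENNReal.ofReal (1 / 2 * (1 / (n : ℝ) ^ a)) :=
    (RQC.lintegral_scramblingError_le G (by omega) t htr S).trans
      (ENNReal.ofReal_le_ofReal (RQC.weightSum_lowProb_le a hn52 hnb hf0 hhalf hfn hS ht hsmall
        hρ htr))
  refine ⟨hexp.trans (ENNReal.ofReal_le_ofReal hhalf_le), ?_⟩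
  refine (RQC.lintegral_cond_le _ ?_ _).trans ((mul_le_mul' le_rfl hexp).trans_eq ?_)
  · have hcompl : {ω : Fin t → RQC.Gate G n |
        (RQC.depth ω : ℝ) ≤ (16 * c' + a + 2) * Real.logb 2 n ^ 3}ᶜ =
        {ω | (16 * c' + a + 2) * Real.logb 2 n ^ 3 < (RQC.depth ω : ℝ)} := by
      ext ω
      simp
    rw [hcompl]
    refine hdepth.trans ((ENNReal.ofReal_le_ofReal (q := 1 / 2) ?_).trans_eq ?_)
    · have : 1 / (n : ℝ) ^ a ≤ 1 := by
        rw [div_le_one hna]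
        exact one_le_pow₀ (by exact_mod_cast (by omega : 1 ≤ n))
      linarith
    · rw [ENNReal.ofReal_div_of_pos (by norm_num)]
      simp
  · rw [← ENNReal.ofReal_ofNat, ← ENNReal.ofReal_mul (by norm_num)]
    congr 1
    ring
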